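/- A semigroup $S$ is called nilpotent if $|S^{c+1}|=1$ for some integer $c\ge 0$, where $S^{k}$ denotes the set of all products of $k$ elements of $S$; the least such $c$ is the class of $S$. The coclass of a finite nilpotent semigroup $S$ of class $c$ is $|S|-1-c$. Let $n\ge 7$ be an integer. Then the number of nilpotent semigroups of order $n$ and coclass $2$ having a minimal generating set of size $2$ 1. equals $5n+\lfloor n/2\rfloor-\lceil n/3\rceil-1$ when counted up to isomorphism or anti-isomorphism; 2. equals $7n-\lceil n/3\rceil+5$ when counted up to isomorphism; 3. equals $3n+2\lfloor n/2\rfloor-\lceil n/3\rceil-8$ when only commutative semigroups are counted, up to isomorphism. -/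

import Mathlib

namespace CoclassCount

open scoped Pointwise

/-- `powSucc S k` is the set `S ^ (k + 1)` of all products of `k + 1` elements of `S`. -/
def powSucc (S : Type*) [Semigroup S] : ℕ → Set S
  | 0 => Set.univ
  | k + 1 => powSucc S k * Set.univ

/-- `S` is nilpotent if `|S ^ (c + 1)| = 1` for some natural number `c` (possibly `0`). -/
def IsNilpotentSemigroup (S : Type*) [Semigroup S] : Prop :=
  ∃ c : ℕ, (powSucc S c).ncard = 1

/-- The nilpotency class: the least `c` with `|S ^ (c + 1)| = 1`
(only meaningful if `S` is nilpotent). -/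
noncomputable def nilClass (S : Type*) [Semigroup S] : ℕ :=
  sInf {c : ℕ | (powSucc S c).ncard = 1}

/-- `S` is a finite nilpotent semigroup of coclass `r`, that is `r = |S| - 1 - c`
where `c` is the nilpotency class of `S`. -/
def HasCoclass (S : Type*) [Semigroup S] (r : ℕ) : Prop :=
  Finite S ∧ IsNilpotentSemigroup S ∧ (Nat.card S : ℤ) - 1 - (nilClass S : ℤ) = (r : ℤ)

/-- `S` has an (inclusion-)minimal generating set with exactly `d` elements. -/
def HasMinimalGeneratingSetOfSize (S : Type*) [Semigroup S] (d : ℕ) : Prop :=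
  ∃ A : Set S, A.Finite ∧ Minimal (fun B : Set S => Subsemigroup.closure B = ⊤) A ∧ A.ncard = d

/-- The set `{0, …, n - 1}`, regarded as a semigroup through the structure `s`
(and not through the arithmetic of `Fin n`). Every semigroup of order `n` is isomorphic to one
of these. -/
def Carrier {n : ℕ} (_s : Semigroup (Fin n)) : Type := Fin n

instance instSemigroupCarrier {n : ℕ} (s : Semigroup (Fin n)) : Semigroup (Carrier s) := s

/-- Isomorphism of semigroups of order `n`. -/
def isoSetoid (n : ℕ) : Setoid (Semigroup (Fin n)) where
  r s t := Nonempty (Carrier s ≃* Carrier t)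
  iseqv :=
    { refl := fun s => ⟨MulEquiv.refl (Carrier s)⟩
      symm := fun ⟨e⟩ => ⟨e.symm⟩
      trans := fun ⟨e⟩ ⟨f⟩ => ⟨e.trans f⟩ }

/-- Being isomorphic or anti-isomorphic, for semigroups of order `n`. -/
def isoOrAntiSetoid (n : ℕ) : Setoid (Semigroup (Fin n)) where
  r s t := Nonempty (Carrier s ≃* Carrier t) ∨ Nonempty (Carrier s ≃* (Carrier t)ᵐᵒᵖ)
  iseqv :=
    { refl := fun s => Or.inl ⟨MulEquiv.refl (Carrier s)⟩
      symm := by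
        rintro s t (⟨⟨e⟩⟩ | ⟨⟨e⟩⟩)
        · exact Or.inl ⟨e.symm⟩
        · exact Or.inr ⟨(MulEquiv.opOp (Carrier t)).trans (MulEquiv.op e.symm)⟩
      trans := by
        rintro s t w (⟨⟨e⟩⟩ | ⟨⟨e⟩⟩) (⟨⟨f⟩⟩ | ⟨⟨f⟩⟩)
        · exact Or.inl ⟨e.trans f⟩
        · exact Or.inr ⟨e.trans f⟩
        · exact Or.inr ⟨e.trans (MulEquiv.op f)⟩
        · exact Or.inl ⟨(e.trans (MulEquiv.op f)).trans (MulEquiv.opOp (Carrier w)).symm⟩ }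

/-- The number of semigroups of order `n` with property `P`, counted up to `r`. -/
noncomputable def countUpTo {n : ℕ} (r : Setoid (Semigroup (Fin n)))
    (P : Semigroup (Fin n) → Prop) : ℕ :=
  Nat.card (Quotient (r.comap (Subtype.val : {s : Semigroup (Fin n) // P s} → Semigroup (Fin n))))

/-- The semigroup is nilpotent of coclass `2` with a minimal generating set of size `2`. -/
def IsCoclassTwoTwoGenerated {n : ℕ} (s : Semigroup (Fin n)) : Prop :=
  HasCoclass (Carrier s) 2 ∧ HasMinimalGeneratingSetOfSize (Carrier s) 2

/-- The semigroup is commutative. -/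
def IsCommutativeSemigroup {n : ℕ} (s : Semigroup (Fin n)) : Prop :=
  ∀ a b : Carrier s, a * b = b * a

end CoclassCount

namespace CoclassCount

open scoped Pointwise

/-! ### The chain of powers of `S` and its generating sets -/

section Powers

variable {S : Type*} [Semigroup S]

/-! Put `c = n - 3`, the class. A nilpotent semigroup is minimally generated by `S \ S ^ 2`, so here
`S ^ 2` has `c + 1` elements, and the strictly decreasing chain from `S ^ 2` down to the singleton
`S ^ (c + 1)` has exactly one layer with two elements, all others having one. If the layer `S ^ 2 \
S ^ 3` had one element, `S ^ 2` would consist of powers of a single element and be too small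
(`two_le_ncard_square_layer`); so it is the large one. As `c ≥ 4`, some cube `a ^ 3` lies outside `S
^ 4` (`exists_cube_notMem`), whence `S = {b, z, a, a ^ 2, …, a ^ (c + 1)}` with `a ^ (c + 1)` zero
(`exists_labelling`).

Ten products determine the multiplication, and they are recorded as a `Tab`. Associativity leaves
four families, according to which of `a * b`, `b * a`, `b * b` equal `z` (`good_cases`): `tabC`,
`tabAB`, `tabA` and the opposites of `tabA`. In each, `b` acts by shifting exponents of powers of
`a`, and comparing exponents gives linear equations, except where both sides are already zero.

An isomorphism permutes the generators. If it fixes them, the tables agree; if it exchanges them, `b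
^ 3` also lies outside `S ^ 4`, and a short list of small tables remains, with only two coincidences
(`eq_or_swap_of_mulEquiv`). Counting parameters finishes the proof: the thirds in the formulas come
from `b ^ 3` in `tabC`, the halves from `b ^ 2` in `tabAB` and `tabA`. -/

theorem mul_mem_powSucc {i j : ℕ} {x y : S} (hx : x ∈ powSucc S i) (hy : y ∈ powSucc S j) :
    x * y ∈ powSucc S (i + j + 1) := by
  induction j generalizing y with
  | zero => exact Set.mul_mem_mul hx (Set.mem_univ y)
  | succ j ih =>
    obtain ⟨u, hu, v, -, rfl⟩ := hy
    rw [← mul_assoc]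
    exact Set.mul_mem_mul (ih hu) (Set.mem_univ v)

theorem powSucc_succ_subset (k : ℕ) : powSucc S (k + 1) ⊆ powSucc S k := by
  induction k with
  | zero => exact Set.subset_univ _
  | succ k ih => exact Set.mul_subset_mul_right ih

theorem powSucc_antitone : Antitone (powSucc S) :=
  antitone_nat_of_succ_le powSucc_succ_subset

theorem powSucc_eq_of_succ_eq {k : ℕ} (h : powSucc S (k + 1) = powSucc S k) {j : ℕ} (hj : k ≤ j) :
    powSucc S j = powSucc S k := by
  induction j, hj using Nat.le_induction with
  | base => rfl
  | succ j _ ih =>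
    change powSucc S j * Set.univ = _
    rw [ih]
    exact h

/-- One repetition freezes the chain for good, which would give a singleton before the class; so
every step strictly loses an element. -/
theorem ncard_powSucc_ge [Finite S] {c : ℕ}
    (hmin : ∀ j < c, (powSucc S j).ncard ≠ 1) (hc : (powSucc S c).ncard = 1)
    (j k : ℕ) (h : k + j = c) : j + 1 ≤ (powSucc S k).ncard := by
  induction j generalizing k with
  | zero =>
    obtain rfl : k = c := by omega
    omega
  | succ j ih =>
    have h1 := ih (k + 1) (by omega)
    have h2 : powSucc S (k + 1) ⊂ powSucc S k := by
      refine (powSucc_succ_subset k).ssubset_of_ne fun he => ?_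
      have := powSucc_eq_of_succ_eq he (j := c) (by omega)
      exact hmin k (by omega) (this ▸ hc)
    have := Set.ncard_lt_ncard h2 (Set.toFinite _)
    omega

/-- `spow a k` is `a ^ (k + 1)`. -/
def spow (a : S) : ℕ → S
  | 0 => a
  | k + 1 => spow a k * a

theorem spow_mul_spow (a : S) (i j : ℕ) : spow a i * spow a j = spow a (i + j + 1) := by
  induction j with
  | zero => rfl
  | succ j ih =>
    change spow a i * (spow a j * a) = _
    rw [← mul_assoc, ih]
    rfl

theorem spow_mem_powSucc (a : S) (k : ℕ) : spow a k ∈ powSucc S k := by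
  induction k with
  | zero => exact Set.mem_univ _
  | succ k ih => exact Set.mul_mem_mul ih (Set.mem_univ a)

/-- If every product `a ^ (k + 1) * s` is `a ^ (k + 2)` up to longer products, then so is every
product of at least `k + 1` elements. -/
theorem powSucc_subset_insert_spow (a : S) {k : ℕ}
    (h0 : powSucc S (k + 1) ⊆ insert (spow a (k + 1)) (powSucc S (k + 2))) {j : ℕ}
    (hj : k + 1 ≤ j) : powSucc S j ⊆ insert (spow a j) (powSucc S (j + 1)) := by
  induction j, hj using Nat.le_induction with
  | base => exact h0
  | succ j hj ih =>
    rintro _ ⟨x, hx, s, -, rfl⟩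
    rcases ih hx with rfl | hx
    · have h1 : spow a k * s ∈ powSucc S (k + 1) := Set.mul_mem_mul (spow_mem_powSucc a k) trivial
      obtain ⟨i, rfl⟩ : ∃ i, j = i + k + 1 := ⟨j - k - 1, by omega⟩
      have h2 : spow a (i + k + 1) * s = spow a i * (spow a k * s) := by
        rw [← mul_assoc, spow_mul_spow]
      change spow a (i + k + 1) * s ∈ _
      rw [h2]
      rcases h0 h1 with h | h
      · left
        rw [h, spow_mul_spow]
        congr 1
      · right
        have := mul_mem_powSucc (spow_mem_powSucc a i) h
        rwa [show i + (k + 2) + 1 = i + k + 1 + 1 + 1 by omega] at this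
    · right
      exact Set.mul_mem_mul hx trivial

/-- Each layer from `k` on contributes at most one new element, a power of `a`; the last set is a
singleton and hence consists of its own power of `a`. -/
theorem powSucc_subset_range_spow (a : S) {k c : ℕ}
    (h : ∀ j, k ≤ j → powSucc S j ⊆ insert (spow a j) (powSucc S (j + 1)))
    (hc : (powSucc S c).ncard = 1) (hkc : k ≤ c) :
    powSucc S k ⊆ spow a '' Set.Icc k c := by
  obtain ⟨d, rfl⟩ : ∃ d, c = k + d := ⟨c - k, by omega⟩
  induction d generalizing k with
  | zero =>
    obtain ⟨z, hz⟩ := Set.ncard_eq_one.mp hc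
    intro x hx
    have h1 := spow_mem_powSucc a k
    rw [add_zero] at hz
    rw [hz] at hx h1
    exact ⟨k, by simp, by rw [h1, hx]⟩
  | succ d ih =>
    intro x hx
    rcases h k le_rfl hx with rfl | hx
    · exact ⟨k, by simp, rfl⟩
    · have e : k + 1 + d = k + (d + 1) := by omega
      have := ih (k := k + 1) (fun j hj => h j (by omega)) (by rwa [e]) (by omega) hx
      rw [e] at this
      obtain ⟨i, hi, rfl⟩ := this
      exact ⟨i, ⟨by have := hi.1; omega, hi.2⟩, rfl⟩

theorem irreducible_mem_of_closure_eq_top {A : Set S} (hA : Subsemigroup.closure A = ⊤) :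
    (powSucc S 1)ᶜ ⊆ A := by
  intro x hx
  have hx' : x ∈ Subsemigroup.closure A := hA ▸ Subsemigroup.mem_top x
  induction hx' using Subsemigroup.closure_induction with
  | mem x h => exact h
  | mul x y _ _ _ _ => exact absurd (Set.mul_mem_mul (Set.mem_univ x) (Set.mem_univ y)) hx

/-- An element outside the closure can be rewritten as an ever longer product, until only the
element of `S ^ (c + 1)` is left. That one is a power of any irreducible element, which is why an
irreducible has to exist. -/
theorem closure_irreducible_eq_top {c : ℕ} (hc : (powSucc S c).ncard = 1)
    (hne : (powSucc S 1)ᶜ.Nonempty) :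
    Subsemigroup.closure ((powSucc S 1)ᶜ : Set S) = ⊤ := by
  set C := Subsemigroup.closure ((powSucc S 1)ᶜ : Set S) with hC
  have step : ∀ d, (∀ x : S, x ∈ C ∨ x ∈ powSucc S d) := by
    intro d
    induction d with
    | zero => exact fun x => Or.inr trivial
    | succ d ih =>
      intro x
      rcases ih x with h | h
      · exact Or.inl h
      rcases d with _ | d
      · by_cases hx : x ∈ powSucc S 1
        · exact Or.inr hx
        · exact Or.inl (Subsemigroup.subset_closure hx)
      · obtain ⟨u, hu, v, -, rfl⟩ := h
        rcases ih u with hu' | hu'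
        · by_cases hv : v ∈ powSucc S 1
          · right
            have := mul_mem_powSucc hu hv
            exact this
          · exact Or.inl (C.mul_mem hu' (Subsemigroup.subset_closure hv))
        · exact Or.inr (Set.mul_mem_mul hu' trivial)
  obtain ⟨g, hg⟩ := hne
  have hgC : g ∈ C := Subsemigroup.subset_closure hg
  have hpow : ∀ k, spow g k ∈ C := by
    intro k
    induction k with
    | zero => exact hgC
    | succ k ih => exact C.mul_mem ih hgC
  obtain ⟨z, hz⟩ := Set.ncard_eq_one.mp hc
  have hzC : z ∈ C := by
    have := spow_mem_powSucc g c
    rw [hz] at this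
    rw [← show spow g c = z from this]
    exact hpow c
  refine eq_top_iff.mpr fun x _ => ?_
  rcases step c x with h | h
  · exact h
  · rw [hz] at h
    rw [show x = z from h]
    exact hzC

/-- A nilpotent semigroup has exactly one minimal generating set, namely `S \ S ^ 2`. -/
theorem hasMinimalGeneratingSetOfSize_iff [Finite S] {c d : ℕ} (hc : (powSucc S c).ncard = 1)
    (hne : (powSucc S 1)ᶜ.Nonempty) :
    HasMinimalGeneratingSetOfSize S d ↔ ((powSucc S 1)ᶜ : Set S).ncard = d := by
  have hgen := closure_irreducible_eq_top hc hne
  constructor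
  · rintro ⟨A, -, hA, rfl⟩
    have hsub := irreducible_mem_of_closure_eq_top hA.prop
    rw [hsub.antisymm (hA.le_of_le hgen hsub)]
  · intro h
    exact ⟨_, Set.toFinite _, ⟨hgen, fun B hB _ => irreducible_mem_of_closure_eq_top hB⟩, h⟩

end Powers

/-! ### The sizes of the layers and the normal form of the elements -/

section Structure

theorem subset_insert_of_ncard_le {S : Type*} [Finite S] {A B : Set S} (hBA : B ⊆ A)
    (h : A.ncard ≤ B.ncard + 1) {w : S} (hw : w ∈ A) (hwB : w ∉ B) : A ⊆ insert w B := by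
  have h1 : (insert w B).ncard = B.ncard + 1 := Set.ncard_insert_of_notMem hwB (Set.toFinite _)
  have h2 : insert w B ⊆ A := Set.insert_subset hw hBA
  exact (Set.eq_of_subset_of_ncard_le h2 (by omega) (Set.toFinite _)).ge

variable {S : Type*} [Semigroup S]

theorem mul_mem_powSucc_of_left {i j k : ℕ} {x : S} (hx : x ∈ powSucc S i) (y : S)
    (hy : y ∈ powSucc S j) (h : k ≤ i + j + 1) : x * y ∈ powSucc S k :=
  powSucc_antitone h (mul_mem_powSucc hx hy)

theorem two_le_ncard_square_layer [Finite S] {c : ℕ} (hc : (powSucc S c).ncard = 1)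
    (hc1 : 3 ≤ c) (h1 : (powSucc S 1).ncard = c + 1) (h23 : ¬ powSucc S 2 ⊆ powSucc S 3) :
    (powSucc S 2).ncard + 2 ≤ (powSucc S 1).ncard := by
  by_contra! hlt
  have hins : ∀ w ∈ powSucc S 1, w ∉ powSucc S 2 → powSucc S 1 ⊆ insert w (powSucc S 2) :=
    fun w hw hw' => subset_insert_of_ncard_le (powSucc_antitone (show 1 ≤ 2 by norm_num)) (by omega) hw hw'
  -- If `u * v * t` is outside `S ^ 4`, then `u * v` and `v * t` both lie in the one-element layer,
  -- so they agree and `u * v * t = v * (t * t)`; this is too deep if `t * t` is in `S ^ 3`.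
  have key : ∃ a : S, a * a ∉ powSucc S 2 := by
    by_contra! hsq
    obtain ⟨_, ⟨_, ⟨u, -, v, -, rfl⟩, t, -, rfl⟩, hx⟩ := Set.not_subset.mp h23
    have huv : u * v ∉ powSucc S 2 := fun h => hx (Set.mul_mem_mul h trivial)
    have hvt : v * t ∉ powSucc S 2 := fun h => by
      apply hx
      change u * v * t ∈ _
      rw [mul_assoc]
      exact mul_mem_powSucc_of_left (i := 0) trivial _ h le_rfl
    have he : v * t = u * v := by
      have := hins _ (Set.mul_mem_mul (Set.mem_univ u) (Set.mem_univ v)) huv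
        (Set.mul_mem_mul (Set.mem_univ v) (Set.mem_univ t))
      exact this.resolve_right hvt
    apply hx
    change u * v * t ∈ _
    rw [← he, mul_assoc]
    exact mul_mem_powSucc_of_left (i := 0) trivial _ (hsq t) le_rfl
  obtain ⟨a, ha⟩ := key
  have hsub := hins (spow a 1) (spow_mem_powSucc a 1) ha
  -- Then `S ^ 2` would consist of `a ^ 2, …, a ^ (c + 1)`, at most `c` elements instead of `c + 1`.
  have hrange := powSucc_subset_range_spow a (k := 1)
    (fun j hj => powSucc_subset_insert_spow a (k := 0) hsub hj) hc (by omega)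
  have h3 := (Set.ncard_le_ncard hrange (Set.toFinite _)).trans
    (Set.ncard_image_le (Set.finite_Icc 1 c))
  rw [Set.ncard_eq_toFinset_card' (Set.Icc 1 c)] at h3
  simp at h3
  omega

/-- Take `x * y * z * t` outside `S ^ 5`. As the layer `S ^ 3 \ S ^ 4` has one element, a window of
three factors may be replaced by the next one, which turns the product into `z * t * t * t`; so `t ^
3` cannot be in `S ^ 4`. -/
theorem exists_cube_notMem [Finite S] (h23 : (powSucc S 2).ncard ≤ (powSucc S 3).ncard + 1)
    (h34 : ¬ powSucc S 3 ⊆ powSucc S 4) : ∃ a : S, a * a * a ∉ powSucc S 3 := by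
  have hins : ∀ w ∈ powSucc S 2, w ∉ powSucc S 3 → powSucc S 2 ⊆ insert w (powSucc S 3) :=
    fun w hw hw' => subset_insert_of_ncard_le (powSucc_antitone (show 2 ≤ 3 by norm_num)) h23 hw hw'
  have h3 : ∀ u v t : S, u * v * t ∈ powSucc S 2 := fun u v t =>
    Set.mul_mem_mul (Set.mul_mem_mul trivial trivial) trivial
  obtain ⟨_, ⟨_, ⟨_, ⟨x, -, y, -, rfl⟩, z, -, rfl⟩, t, -, rfl⟩, hx⟩ := Set.not_subset.mp h34
  change x * y * z * t ∉ _ at hx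
  refine ⟨t, fun ht => hx ?_⟩
  have hright : ∀ u v : S, v ∈ powSucc S 3 → u * v ∈ powSucc S 4 := fun u v hv =>
    mul_mem_powSucc_of_left (i := 0) trivial _ hv le_rfl
  have h1 : x * y * z ∉ powSucc S 3 := fun h => hx (Set.mul_mem_mul h trivial)
  have h2 : y * z * t ∉ powSucc S 3 := fun h => hx (by
    have := hright x _ h
    simpa only [mul_assoc] using this)
  have e1 : y * z * t = x * y * z := (hins _ (h3 x y z) h1 (h3 y z t)).resolve_right h2
  rw [← e1] at hx ⊢
  have h4 : z * t * t ∉ powSucc S 3 := fun h => hx (by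
    have := hright y _ h
    simpa only [mul_assoc] using this)
  have e2 : z * t * t = y * z * t := (hins _ (h3 y z t) h2 (h3 z t t)).resolve_right h4
  rw [← e2]
  have := hright z _ ht
  simpa only [mul_assoc] using this

/-- The labelling of a semigroup generated by `a` and `b` with
`S = {b, y, a, a ^ 2, …, a ^ (c + 1)}`. -/
def label (c : ℕ) (a b y : S) (i : Fin (c + 3)) : S :=
  if i.val = 0 then b else if i.val = 1 then y else spow a (i.val - 2)

/-- The size count makes `S ^ 3 \ S ^ 4` a single element, so a cube outside `S ^ 4` has powers
exhausting `S ^ 3`. The bound `4 ≤ c` provides the strict inclusion of `S ^ 5` in `S ^ 4` needed to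
find that cube. -/
theorem exists_labelling [Finite S] {c : ℕ} (hc : (powSucc S c).ncard = 1)
    (hmin : ∀ j < c, (powSucc S j).ncard ≠ 1) (hc4 : 4 ≤ c) (hcard : Nat.card S = c + 3)
    (hgen : ((powSucc S 1)ᶜ : Set S).ncard = 2) :
    ∃ a b y : S, Function.Bijective (label c a b y) ∧ a ∉ powSucc S 1 ∧ b ∉ powSucc S 1 ∧
      y ∈ powSucc S 1 ∧ a * a ∉ powSucc S 2 ∧ y ∉ powSucc S 2 ∧
      (∀ j, c ≤ j → spow a j = spow a c) := by
  have hstrict : ∀ k < c, ¬ powSucc S k ⊆ powSucc S (k + 1) := fun k hk h => by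
    have := powSucc_eq_of_succ_eq ((powSucc_succ_subset k).antisymm h) hk.le
    exact hmin k hk (this ▸ hc)
  have h1 : (powSucc S 1).ncard = c + 1 := by
    have := Set.ncard_add_ncard_compl (powSucc S 1)
    omega
  have hd1 := two_le_ncard_square_layer hc (by omega) h1 (hstrict 2 (by omega))
  have h2 := ncard_powSucc_ge hmin hc (c - 2) 2 (by omega)
  have h3 := ncard_powSucc_ge hmin hc (c - 3) 3 (by omega)
  obtain ⟨a, ha⟩ := exists_cube_notMem (by omega) (hstrict 3 (by omega))
  have hsub := subset_insert_of_ncard_le (powSucc_antitone (show 2 ≤ 3 by norm_num)) (by omega)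
    (spow_mem_powSucc a 2) ha
  have hrange := powSucc_subset_range_spow a (k := 2)
    (fun j hj => powSucc_subset_insert_spow a (k := 1) hsub hj) hc (by omega)
  have ha1 : a ∉ powSucc S 1 := fun h => ha <|
    mul_mem_powSucc_of_left (mul_mem_powSucc_of_left h a h le_rfl) a h (by norm_num)
  have haa : a * a ∉ powSucc S 2 := fun h => ha (Set.mul_mem_mul h trivial)
  obtain ⟨b, hb⟩ : ∃ b, (powSucc S 1)ᶜ = {a, b} := by
    obtain ⟨u, v, -, huv⟩ := Set.ncard_eq_two.mp hgen
    have : a ∈ ({u, v} : Set S) := huv ▸ ha1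
    rcases this with rfl | rfl
    · exact ⟨v, huv⟩
    · exact ⟨u, by rw [huv, Set.pair_comm]⟩
  have hb1 : b ∉ powSucc S 1 := by
    have : b ∈ (powSucc S 1)ᶜ := by simp [hb]
    exact this
  have hlayer : (powSucc S 1 \ powSucc S 2).ncard = 2 := by
    rw [Set.ncard_sdiff (powSucc_antitone (show 1 ≤ 2 by norm_num))]
    omega
  obtain ⟨y, hy⟩ : ∃ y, powSucc S 1 \ powSucc S 2 = {a * a, y} := by
    obtain ⟨u, v, -, huv⟩ := Set.ncard_eq_two.mp hlayer
    have : a * a ∈ ({u, v} : Set S) := huv ▸ ⟨spow_mem_powSucc a 1, haa⟩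
    rcases this with rfl | rfl
    · exact ⟨v, huv⟩
    · exact ⟨u, by rw [huv, Set.pair_comm]⟩
  have hy1 : y ∈ powSucc S 1 \ powSucc S 2 := by simp [hy]
  refine ⟨a, b, y, ?_, ha1, hb1, hy1.1, haa, hy1.2, ?_⟩
  · have hsurj : Function.Surjective (label c a b y) := by
      intro x
      by_cases hx1 : x ∈ powSucc S 1
      · by_cases hx2 : x ∈ powSucc S 2
        · obtain ⟨i, hi, rfl⟩ := hrange hx2
          have := hi.2
          exact ⟨⟨i + 2, by omega⟩, by simp [label]⟩
        · have : x ∈ ({a * a, y} : Set S) := hy ▸ ⟨hx1, hx2⟩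
          rcases this with rfl | rfl
          · exact ⟨⟨3, by omega⟩, by simp [label, spow]⟩
          · exact ⟨⟨1, by omega⟩, by simp [label]⟩
      · have : x ∈ ({a, b} : Set S) := hb ▸ hx1
        rcases this with rfl | rfl
        · exact ⟨⟨2, by omega⟩, by simp [label, spow]⟩
        · exact ⟨⟨0, by omega⟩, by simp [label]⟩
    exact hsurj.bijective_of_nat_card_le (by simp [hcard])
  · intro j hj
    obtain ⟨z, hz⟩ := Set.ncard_eq_one.mp hc
    have h5 := powSucc_antitone hj (spow_mem_powSucc a j)
    have h6 := spow_mem_powSucc a c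
    rw [hz] at h5 h6
    exact Eq.trans h5 (Eq.symm h6)

end Structure

/-! ### Multiplication tables and the semigroups that they define -/

/-- Products in a semigroup `{b, z, a, a ^ 2, …, a ^ (c + 1)}` in which `a ^ (c + 1)` is zero. The
elements are coded by `b ↦ 0`, `z ↦ 1` and `a ^ (i + 1) ↦ i + 2`; the fields are the codes of the
products that they name. -/
@[ext]
structure Tab where
  ab : ℕ
  aab : ℕ
  ba : ℕ
  baa : ℕ
  bb : ℕ
  az : ℕ
  za : ℕ
  zb : ℕ
  bz : ℕ
  zz : ℕ
  deriving DecidableEq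

namespace Tab

/-- The multiplication on codes described by `t`. -/
def mul (c : ℕ) (t : Tab) : ℕ → ℕ → ℕ
  | 0, 0 => t.bb
  | 0, 1 => t.bz
  | 1, 0 => t.zb
  | 1, 1 => t.zz
  | 0, 2 => t.ba
  | 2, 0 => t.ab
  | 0, j + 3 => min (t.baa + j) (c + 2)
  | i + 3, 0 => min (t.aab + i) (c + 2)
  | 1, j + 2 => min (t.za + j) (c + 2)
  | i + 2, 1 => min (t.az + i) (c + 2)
  | i + 2, j + 2 => min (i + j + 3) (c + 2)

/-- The codes in `t` lie where products of generators have to lie. -/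
structure Bounded (c : ℕ) (t : Tab) : Prop where
  ab : t.ab = 1 ∨ 3 ≤ t.ab ∧ t.ab ≤ c + 2
  ba : t.ba = 1 ∨ 3 ≤ t.ba ∧ t.ba ≤ c + 2
  bb : t.bb = 1 ∨ 3 ≤ t.bb ∧ t.bb ≤ c + 2
  exists_one : t.ab = 1 ∨ t.ba = 1 ∨ t.bb = 1
  aab : 4 ≤ t.aab ∧ t.aab ≤ c + 2
  baa : 4 ≤ t.baa ∧ t.baa ≤ c + 2
  az : 4 ≤ t.az ∧ t.az ≤ c + 2
  za : 4 ≤ t.za ∧ t.za ≤ c + 2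
  zb : 4 ≤ t.zb ∧ t.zb ≤ c + 2
  bz : 4 ≤ t.bz ∧ t.bz ≤ c + 2
  zz : 4 ≤ t.zz ∧ t.zz ≤ c + 2

/-- `t` is the multiplication table of a semigroup of order `c + 3` and class `c`. -/
structure Good (c : ℕ) (t : Tab) : Prop extends Bounded c t where
  assoc : ∀ x y z : ℕ, x ≤ c + 2 → y ≤ c + 2 → z ≤ c + 2 →
    mul c t (mul c t x y) z = mul c t x (mul c t y z)

variable {c : ℕ} {t : Tab}

theorem mul_le (h : Bounded c t) (x y : ℕ) : mul c t x y ≤ c + 2 := by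
  have := h.ab; have := h.ba; have := h.bb; have := h.zb; have := h.bz; have := h.zz
  have := h.aab
  unfold mul
  split <;> omega

/-- The semigroup of order `c + 3` with multiplication table `t`. -/
@[reducible]
def semigroup (h : Good c t) : Semigroup (Fin (c + 3)) where
  mul x y := ⟨mul c t x y, Nat.lt_succ_of_le (mul_le h.toBounded x y)⟩
  mul_assoc x y z := Fin.ext <| h.assoc x y z (Nat.le_of_lt_succ x.2) (Nat.le_of_lt_succ y.2)
    (Nat.le_of_lt_succ z.2)

/-- The code of an element. -/
def code {n : ℕ} {s : Semigroup (Fin n)} (x : Carrier s) : ℕ := Fin.val x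

theorem code_mul (h : Good c t) (x y : Carrier (semigroup h)) :
    code (x * y) = mul c t (code x) (code y) := rfl

theorem code_le {s : Semigroup (Fin (c + 3))} (x : Carrier s) : code x ≤ c + 2 :=
  Nat.le_of_lt_succ (Fin.is_lt x)

theorem code_injective {n : ℕ} {s : Semigroup (Fin n)} :
    Function.Injective (code : Carrier s → ℕ) := Fin.val_injective

theorem exists_code_eq {s : Semigroup (Fin (c + 3))} {i : ℕ} (hi : i ≤ c + 2) :
    ∃ x : Carrier s, code x = i := ⟨(⟨i, by omega⟩ : Fin (c + 3)), rfl⟩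

theorem mul_ne (h : Bounded c t) (hc : 4 ≤ c) (x y : ℕ) : mul c t x y ≠ 0 ∧ mul c t x y ≠ 2 := by
  have := h.ab; have := h.ba; have := h.bb; have := h.zb; have := h.bz; have := h.zz
  have := h.aab; have := h.baa; have := h.az; have := h.za
  unfold mul
  split <;> omega

theorem mul_ge_of_left (h : Bounded c t) (hc : 4 ≤ c) {x : ℕ} (hx : x ≠ 0) (hx' : x ≠ 2)
    (y : ℕ) : 4 ≤ mul c t x y := by
  have := h.zb; have := h.zz
  have := h.aab; have := h.az; have := h.za
  unfold mul
  split <;> omega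

theorem mul_ge_succ (h : Bounded c t) {x : ℕ} (hx : 3 ≤ x) (y : ℕ) :
    min (x + 1) (c + 2) ≤ mul c t x y := by
  have := h.aab; have := h.az
  unfold mul
  split <;> omega

theorem mul_add_two (i j : ℕ) : mul c t (i + 2) (j + 2) = min (i + j + 3) (c + 2) := by
  unfold mul
  split <;> simp_all

theorem mem_powSucc_one (h : Good c t) (hc : 4 ≤ c) (x : Carrier (semigroup h)) :
    x ∈ powSucc (Carrier (semigroup h)) 1 ↔ code x ≠ 0 ∧ code x ≠ 2 := by
  constructor
  · rintro ⟨u, -, v, -, rfl⟩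
    exact mul_ne h.toBounded hc (code u) (code v)
  · rintro ⟨h0, h2⟩
    have hx := code_le x
    suffices ∃ i j, i ≤ c + 2 ∧ j ≤ c + 2 ∧ mul c t i j = code x by
      obtain ⟨i, j, hi, hj, hij⟩ := this
      obtain ⟨u, rfl⟩ := exists_code_eq (s := semigroup h) hi
      obtain ⟨v, rfl⟩ := exists_code_eq (s := semigroup h) hj
      exact ⟨u, trivial, v, trivial, code_injective hij⟩
    by_cases h1 : code x = 1
    · rw [h1]
      rcases h.exists_one with h | h | h
      · exact ⟨2, 0, by omega, by omega, h⟩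
      · exact ⟨0, 2, by omega, by omega, h⟩
      · exact ⟨0, 0, by omega, by omega, h⟩
    · obtain ⟨i, hi⟩ : ∃ i, code x = i + 3 := ⟨code x - 3, by omega⟩
      refine ⟨0 + 2, i + 2, by omega, by omega, ?_⟩
      rw [mul_add_two]
      omega

/-- From `S ^ 3` on, the powers are final segments of the codes, so the class can be read off; the
cap `c + 2` is the code of zero. -/
theorem mem_powSucc_add_two (h : Good c t) (hc : 4 ≤ c) (k : ℕ) (x : Carrier (semigroup h)) :
    x ∈ powSucc (Carrier (semigroup h)) (k + 2) ↔ min (k + 4) (c + 2) ≤ code x := by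
  induction k generalizing x with
  | zero =>
    constructor
    · rintro ⟨u, hu, v, -, rfl⟩
      obtain ⟨h0, h2⟩ := (mem_powSucc_one h hc u).mp hu
      exact min_le_of_left_le (mul_ge_of_left h.toBounded hc h0 h2 (code v))
    · intro hx
      have := code_le x
      obtain ⟨i, hi⟩ : ∃ i, code x = i + 4 := ⟨code x - 4, by omega⟩
      obtain ⟨u, hu⟩ := exists_code_eq (s := semigroup h) (i := i + 3) (by omega)
      obtain ⟨v, hv⟩ := exists_code_eq (s := semigroup h) (i := 2) (by omega)
      refine ⟨u, (mem_powSucc_one h hc u).mpr (by omega), v, trivial, code_injective ?_⟩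
      change mul c t (code u) (code v) = _
      rw [hu, hv, mul_add_two (i + 1) 0]
      omega
  | succ k ih =>
    constructor
    · rintro ⟨u, hu, v, -, rfl⟩
      have hu := (ih u).mp hu
      have := mul_ge_succ h.toBounded (x := code u) (by omega) (code v)
      change _ ≤ mul c t (code u) (code v)
      omega
    · intro hx
      have := code_le x
      obtain ⟨i, hi⟩ : ∃ i, code x = i + 4 := ⟨code x - 4, by omega⟩
      -- Right multiplication by `a` raises the code of a power by one and fixes the code `c + 2` of
      -- zero, so zero is its own left factor here.
      obtain ⟨u, hu⟩ := exists_code_eq (s := semigroup h)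
        (i := if code x = c + 2 then c + 2 else code x - 1) (by split <;> omega)
      obtain ⟨v, hv⟩ := exists_code_eq (s := semigroup h) (i := 2) (by omega)
      refine ⟨u, (ih u).mpr (by rw [hu]; split <;> omega), v, trivial, code_injective ?_⟩
      change mul c t (code u) (code v) = _
      obtain ⟨j, hj⟩ : ∃ j, code u = j + 2 := ⟨code u - 2, by rw [hu]; split <;> omega⟩
      rw [hj, hv, mul_add_two j 0]
      split at hu <;> omega

theorem isCoclassTwoTwoGenerated (h : Good c t) (hc : 4 ≤ c) :
    IsCoclassTwoTwoGenerated (semigroup h) := by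
  have : Finite (Carrier (semigroup h)) := inferInstanceAs (Finite (Fin (c + 3)))
  have hcard : Nat.card (Carrier (semigroup h)) = c + 3 := Nat.card_fin (c + 3)
  have hclass : (powSucc (Carrier (semigroup h)) c).ncard = 1 := by
    obtain ⟨x, hx⟩ := exists_code_eq (s := semigroup h) (i := c + 2) le_rfl
    rw [Set.ncard_eq_one]
    refine ⟨x, Set.ext fun u => ?_⟩
    obtain ⟨k, rfl⟩ : ∃ k, c = k + 2 := ⟨c - 2, by omega⟩
    rw [mem_powSucc_add_two h hc, Set.mem_singleton_iff, ← code_injective.eq_iff, hx]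
    have := code_le u
    omega
  have hmin : ∀ j < c, (powSucc (Carrier (semigroup h)) j).ncard ≠ 1 := by
    intro j hj h1
    obtain ⟨x, hx⟩ := exists_code_eq (s := semigroup h) (i := c + 2) le_rfl
    obtain ⟨y, hy⟩ := exists_code_eq (s := semigroup h) (i := c + 1) (by omega)
    have hmem : ∀ u : Carrier (semigroup h), c + 1 ≤ code u →
        u ∈ powSucc (Carrier (semigroup h)) j := by
      intro u hu
      rcases j with _ | _ | k
      · trivial
      · exact (mem_powSucc_one h hc u).mpr (by omega)
      · exact (mem_powSucc_add_two h hc k u).mpr (by omega)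
    obtain ⟨z, hz⟩ := Set.ncard_eq_one.mp h1
    have hx' := hmem x (by omega)
    have hy' := hmem y (by omega)
    rw [hz, Set.mem_singleton_iff] at hx' hy'
    rw [hx', ← hy'] at hx
    omega
  have hnil : nilClass (Carrier (semigroup h)) = c := by
    refine IsLeast.csInf_eq ⟨hclass, fun j hj => ?_⟩
    by_contra! hlt
    exact hmin j hlt hj
  have hcompl : ((powSucc (Carrier (semigroup h)) 1)ᶜ : Set _).ncard = 2 := by
    obtain ⟨x, hx⟩ := exists_code_eq (s := semigroup h) (i := 0) (by omega)
    obtain ⟨y, hy⟩ := exists_code_eq (s := semigroup h) (i := 2) (by omega)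
    rw [Set.ncard_eq_two]
    refine ⟨x, y, fun hxy => by rw [hxy] at hx; omega, Set.ext fun u => ?_⟩
    rw [Set.mem_compl_iff, mem_powSucc_one h hc, Set.mem_insert_iff, Set.mem_singleton_iff,
      ← code_injective.eq_iff, ← code_injective.eq_iff, hx, hy]
    omega
  refine ⟨⟨this, ⟨c, hclass⟩, ?_⟩, ?_⟩
  · rw [hcard, hnil]
    push_cast
    ring
  · rw [hasMinimalGeneratingSetOfSize_iff hclass (Set.nonempty_of_ncard_ne_zero (by omega))]
    exact hcompl

end Tab

/-! ### Every semigroup in question comes from a table -/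

section Classification

variable {S : Type*} [Semigroup S]

theorem spow_stable_min {a : S} {c : ℕ} (h : ∀ j, c ≤ j → spow a j = spow a c) (j : ℕ) :
    spow a (min j c) = spow a j := by
  rcases le_total j c with hj | hj
  · rw [min_eq_left hj]
  · rw [min_eq_right hj, h j hj]

theorem exists_good_mulEquiv [Finite S] {c : ℕ} (hc : (powSucc S c).ncard = 1)
    (hmin : ∀ j < c, (powSucc S j).ncard ≠ 1) (hc4 : 4 ≤ c) (hcard : Nat.card S = c + 3)
    (hgen : ((powSucc S 1)ᶜ : Set S).ncard = 2) :
    ∃ (t : Tab) (h : Tab.Good c t), Nonempty (S ≃* Carrier (Tab.semigroup h)) := by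
  obtain ⟨a, b, z, hbij, ha, hb, hz, haa, hz2, hstab⟩ := exists_labelling hc hmin hc4 hcard hgen
  set e := Equiv.ofBijective _ hbij
  let lab : ℕ → S := fun i => if i = 0 then b else if i = 1 then z else spow a (i - 2)
  let code : S → ℕ := fun x => (e.symm x).val
  have hlab0 : lab 0 = b := rfl
  have hlab1 : lab 1 = z := rfl
  have hlab2 : ∀ i, lab (i + 2) = spow a i := fun i => by simp [lab]
  have hcode : ∀ x, lab (code x) = x := fun x => e.apply_symm_apply x
  have hcle : ∀ x, code x ≤ c + 2 := fun x => Nat.le_of_lt_succ (e.symm x).2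
  have hinj : ∀ i j, i ≤ c + 2 → j ≤ c + 2 → lab i = lab j → i = j := fun i j hi hj hij => by
    have := @hbij.1 ⟨i, by omega⟩ ⟨j, by omega⟩ hij
    simpa using this
  have hsq : ∀ x y : S, x * y ∈ powSucc S 1 := fun x y => Set.mul_mem_mul trivial trivial
  have hne : ∀ x i, lab i ≠ x → code x ≠ i := fun x i h h' => h (h' ▸ hcode x)
  have hcode1 : ∀ x ∈ powSucc S 1, code x = 1 ∨ 3 ≤ code x ∧ code x ≤ c + 2 := by
    intro x hx
    have h0 := hne x 0 (fun h => hb (by rw [← h] at hx; exact hx))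
    have h2 := hne x 2 (fun h => ha (by rw [← h] at hx; exact hx))
    have := hcle x
    omega
  have hcode2 : ∀ x ∈ powSucc S 2, 4 ≤ code x ∧ code x ≤ c + 2 := by
    intro x hx
    have := hcode1 x (powSucc_antitone (by norm_num) hx)
    have h1 := hne x 1 (fun h => hz2 (by rw [← h] at hx; exact hx))
    have h3 := hne x 3 (fun h => haa (by rw [← h] at hx; exact hx))
    omega
  have hcube : ∀ x y w : S, x * y * w ∈ powSucc S 2 := fun x y w => Set.mul_mem_mul (hsq x y) trivial
  have hcube' : ∀ x y w : S, x * (y * w) ∈ powSucc S 2 := fun x y w => mul_assoc x y w ▸ hcube x y w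
  have hzl : ∀ x : S, z * x ∈ powSucc S 2 := fun x => Set.mul_mem_mul hz trivial
  have hzr : ∀ x : S, x * z ∈ powSucc S 2 := fun x =>
    mul_mem_powSucc_of_left (i := 0) trivial _ hz le_rfl
  -- `lab` is defined on all of `ℕ`, and every code beyond `c + 2` names zero, so capping does not
  -- change the element.
  have hlabmin : ∀ i, 2 ≤ i → lab (min i (c + 2)) = lab i := fun i hi => by
    obtain ⟨j, rfl⟩ : ∃ j, i = j + 2 := ⟨i - 2, by omega⟩
    rw [show min (j + 2) (c + 2) = min j c + 2 by omega, hlab2, hlab2, spow_stable_min hstab]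
  have hlabr : ∀ i j, 2 ≤ i → lab (i + j + 1) = lab i * spow a j := fun i j hi => by
    obtain ⟨k, rfl⟩ : ∃ k, i = k + 2 := ⟨i - 2, by omega⟩
    rw [show k + 2 + j + 1 = (k + j + 1) + 2 by omega, hlab2, hlab2, spow_mul_spow]
  have hlabl : ∀ i j, 2 ≤ i → lab (i + j + 1) = spow a j * lab i := fun i j hi => by
    rw [hlabr i j hi]
    obtain ⟨k, rfl⟩ : ∃ k, i = k + 2 := ⟨i - 2, by omega⟩
    rw [hlab2, spow_mul_spow, spow_mul_spow, add_comm k j]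
  let t : Tab :=
    { ab := code (a * b), aab := code (a * a * b), ba := code (b * a), baa := code (b * (a * a)),
      bb := code (b * b), az := code (a * z), za := code (z * a), zb := code (z * b),
      bz := code (b * z), zz := code (z * z) }
  -- Only ten products are recorded; the others follow by splitting powers of `a` off one factor.
  have hmul : ∀ i j, lab (Tab.mul c t i j) = lab i * lab j := by
    intro i j
    unfold Tab.mul
    split
    · exact hcode _
    · exact hcode _
    · exact hcode _
    · exact hcode _
    · exact hcode _
    · exact hcode _
    · rename_i j
      have h4 : 4 ≤ t.baa := (hcode2 _ (hcube' _ _ _)).1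
      rw [hlabmin _ (by omega), hlab2 (j + 1), hlab0]
      rcases j with _ | j
      · exact hcode _
      · rw [← add_assoc, hlabr _ _ (by omega), hcode (b * (a * a)), mul_assoc]
        congr 1
        rw [show a * a = spow a 1 from rfl, spow_mul_spow]
        congr 1
        omega
    · rename_i i
      have h4 : 4 ≤ t.aab := (hcode2 _ (hcube _ _ _)).1
      rw [hlabmin _ (by omega), hlab2 (i + 1), hlab0]
      rcases i with _ | i
      · exact hcode _
      · rw [← add_assoc, hlabl _ _ (by omega), hcode (a * a * b), ← mul_assoc]
        congr 1
        rw [show a * a = spow a 1 from rfl, spow_mul_spow]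
    · rename_i j
      have h4 : 4 ≤ t.za := (hcode2 _ (hzl _)).1
      rw [hlabmin _ (by omega), hlab2, hlab1]
      rcases j with _ | j
      · exact hcode _
      · rw [← add_assoc, hlabr _ _ (by omega), hcode (z * a), mul_assoc]
        congr 1
        exact (spow_mul_spow a 0 j).trans (congrArg (spow a) (by omega))
    · rename_i i
      have h4 : 4 ≤ t.az := (hcode2 _ (hzr _)).1
      rw [hlabmin _ (by omega), hlab2, hlab1]
      rcases i with _ | i
      · exact hcode _
      · rw [← add_assoc, hlabl _ _ (by omega), hcode (a * z), ← mul_assoc]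
        congr 1
    · rename_i i j
      rw [hlabmin _ (by omega), show i + j + 3 = (i + 2) + j + 1 by omega, hlabr _ _ (by omega),
        hlab2, hlab2]
  -- Since `z` is in `S ^ 2` but not in `S ^ 3`, both factors of `z` are irreducible, hence `a` or
  -- `b`; and `a * a` is not `z`.
  have hone : t.ab = 1 ∨ t.ba = 1 ∨ t.bb = 1 := by
    obtain ⟨u, -, v, -, huv⟩ := hz
    change u * v = z at huv
    have hmem : ∀ i, i ≠ 0 → i ≠ 2 → lab i ∈ powSucc S 1 := by
      intro i h0 h2
      by_cases h1 : i = 1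
      · rw [h1, hlab1, ← huv]
        exact hsq u v
      · obtain ⟨j, rfl⟩ : ∃ j, i = j + 3 := ⟨i - 3, by omega⟩
        rw [show j + 3 = j + 1 + 2 from rfl, hlab2]
        exact powSucc_antitone (by omega) (spow_mem_powSucc a (j + 1))
    have hu : code u = 0 ∨ code u = 2 := by
      by_contra! h
      have := hmem _ h.1 h.2
      rw [hcode] at this
      exact hz2 (huv ▸ Set.mul_mem_mul this trivial)
    have hv : code v = 0 ∨ code v = 2 := by
      by_contra! h
      have := hmem _ h.1 h.2
      rw [hcode] at this
      exact hz2 (huv ▸ mul_mem_powSucc_of_left (i := 0) trivial _ this le_rfl)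
    have hu' : u = b ∨ u = a :=
      hu.imp (fun h => by rw [← hcode u, h, hlab0]) (fun h => by rw [← hcode u, h]; rfl)
    have hv' : v = b ∨ v = a :=
      hv.imp (fun h => by rw [← hcode v, h, hlab0]) (fun h => by rw [← hcode v, h]; rfl)
    have hz1 : code z = 1 := hinj _ _ (hcle z) (by omega) (hcode z)
    rcases hu' with rfl | rfl <;> rcases hv' with rfl | rfl
    · exact Or.inr (Or.inr ((congrArg code huv).trans hz1))
    · exact Or.inr (Or.inl ((congrArg code huv).trans hz1))
    · exact Or.inl ((congrArg code huv).trans hz1)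
    · have h3 := hinj 3 1 (by omega) (by omega) huv
      omega
  have hbdd : Tab.Bounded c t :=
    { ab := hcode1 _ (hsq _ _), ba := hcode1 _ (hsq _ _), bb := hcode1 _ (hsq _ _)
      exists_one := hone
      aab := hcode2 _ (hcube _ _ _), baa := hcode2 _ (hcube' _ _ _)
      az := hcode2 _ (hzr _), za := hcode2 _ (hzl _), zb := hcode2 _ (hzl _)
      bz := hcode2 _ (hzr _), zz := hcode2 _ (hzr _) }
  have hgood : Tab.Good c t :=
    { toBounded := hbdd
      assoc := fun x y w _ _ _ => hinj _ _ (Tab.mul_le hbdd _ _) (Tab.mul_le hbdd _ _) <| by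
        rw [hmul, hmul, hmul, hmul, mul_assoc] }
  refine ⟨t, hgood, ⟨MulEquiv.symm ?_⟩⟩
  exact
    { toEquiv := e
      map_mul' := fun x y => hmul (Fin.val x) (Fin.val y) }

theorem exists_good_of_isCoclassTwoTwoGenerated {c : ℕ} (hc4 : 4 ≤ c) (s : Semigroup (Fin (c + 3)))
    (hs : IsCoclassTwoTwoGenerated s) :
    ∃ (t : Tab) (h : Tab.Good c t), Nonempty (Carrier s ≃* Carrier (Tab.semigroup h)) := by
  obtain ⟨⟨hfin, hnil, hco⟩, hgen⟩ := hs
  have hcard : Nat.card (Carrier s) = c + 3 := Nat.card_fin (c + 3)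
  have hclass : nilClass (Carrier s) = c := by
    rw [hcard] at hco
    push_cast at hco
    omega
  have hc : (powSucc (Carrier s) c).ncard = 1 := by
    have := Nat.sInf_mem (s := {c : ℕ | (powSucc (Carrier s) c).ncard = 1}) hnil
    change (powSucc (Carrier s) (nilClass (Carrier s))).ncard = 1 at this
    rw [hclass] at this
    exact this
  have hmin : ∀ j < c, (powSucc (Carrier s) j).ncard ≠ 1 := fun j hj h =>
    absurd (hclass.symm.le.trans (Nat.sInf_le h)) (not_le.mpr hj)
  refine exists_good_mulEquiv hc hmin hc4 hcard ?_
  refine (hasMinimalGeneratingSetOfSize_iff hc ?_).mp hgen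
  -- If `S ^ 2 = S`, the chain is constant, so `S` would be a singleton of class `0`.
  rw [Set.nonempty_compl]
  intro h
  have h1 := powSucc_eq_of_succ_eq (S := Carrier s) (k := 0) h (Nat.zero_le c)
  exact hmin 0 (by omega) (h1 ▸ hc)

end Classification

/-! ### Which tables are associative -/

namespace Tab

variable {c : ℕ} {t : Tab} {x y : ℕ}

theorem mul_zero_of_le (h : 3 ≤ y) : mul c t 0 y = min (t.baa + (y - 3)) (c + 2) := by
  unfold mul
  split <;> omega

theorem mul_of_le_zero (h : 3 ≤ x) : mul c t x 0 = min (t.aab + (x - 3)) (c + 2) := by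
  unfold mul
  split <;> omega

theorem mul_one_of_le (h : 2 ≤ y) : mul c t 1 y = min (t.za + (y - 2)) (c + 2) := by
  unfold mul
  split <;> omega

theorem mul_of_le_one (h : 2 ≤ x) : mul c t x 1 = min (t.az + (x - 2)) (c + 2) := by
  unfold mul
  split <;> omega

theorem mul_of_le_of_le (hx : 2 ≤ x) (hy : 2 ≤ y) : mul c t x y = min (x + y - 1) (c + 2) := by
  unfold mul
  split <;> omega

theorem mul_zero_zero : mul c t 0 0 = t.bb := rfl

theorem mul_zero_one : mul c t 0 1 = t.bz := rfl

theorem mul_zero_two : mul c t 0 2 = t.ba := rfl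

theorem mul_one_zero : mul c t 1 0 = t.zb := rfl

theorem mul_two_zero : mul c t 2 0 = t.ab := rfl

theorem mul_one_one : mul c t 1 1 = t.zz := rfl

theorem min_min_add (a k m : ℕ) : min (min a m + k) m = min (a + k) m := by omega

/-- Light's associativity test. -/
theorem good_of_generators (h : Bounded c t)
    (h0 : ∀ x z, x ≤ c + 2 → z ≤ c + 2 → mul c t (mul c t x 0) z = mul c t x (mul c t 0 z))
    (h2 : ∀ x z, x ≤ c + 2 → z ≤ c + 2 → mul c t (mul c t x 2) z = mul c t x (mul c t 2 z)) :
    Good c t where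
  toBounded := h
  assoc := by
    -- The elements that associate in the middle position are closed under products, and `b`, `a`
    -- generate everything.
    let A : ℕ → Prop := fun y => y ≤ c + 2 ∧
      ∀ x z, x ≤ c + 2 → z ≤ c + 2 → mul c t (mul c t x y) z = mul c t x (mul c t y z)
    have hmul : ∀ u v, A u → A v → A (mul c t u v) := fun u v ⟨hu, hu'⟩ ⟨hv, hv'⟩ =>
      ⟨mul_le h _ _, fun x z hx hz => by
        rw [← hu' x v hx hv, hv' _ z (mul_le h _ _) hz, hu' x _ hx (mul_le h _ _), hv' u z hu hz]⟩
    have h0' : A 0 := ⟨by omega, h0⟩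
    have h2' : A 2 := ⟨by omega, h2⟩
    have h1 : A 1 := by
      rcases h.exists_one with h1 | h1 | h1
      · have := hmul 2 0 h2' h0'
        rwa [mul_two_zero, h1] at this
      · have := hmul 0 2 h0' h2'
        rwa [mul_zero_two, h1] at this
      · have := hmul 0 0 h0' h0'
        rwa [mul_zero_zero, h1] at this
    have h3 : ∀ i, i + 2 ≤ c + 2 → A (i + 2) := by
      intro i
      induction i with
      | zero => exact fun _ => h2'
      | succ i ih =>
        intro hi
        have := hmul 2 (i + 2) h2' (ih (by omega))
        rwa [mul_of_le_of_le (by omega) (by omega),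
          show min (2 + (i + 2) - 1) (c + 2) = i + 1 + 2 by omega] at this
    intro x y z hx hy hz
    refine (?_ : A y).2 x z hx hz
    match y with
    | 0 => exact h0'
    | 1 => exact h1
    | i + 2 => exact h3 i hy

/-- The table of the opposite semigroup. -/
def op (t : Tab) : Tab :=
  { ab := t.ba, aab := t.baa, ba := t.ab, baa := t.aab, bb := t.bb,
    az := t.za, za := t.az, zb := t.bz, bz := t.zb, zz := t.zz }

theorem op_op (t : Tab) : t.op.op = t := rfl

theorem mul_op (x y : ℕ) : mul c t.op x y = mul c t y x := by
  conv_lhs => unfold mul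
  split <;> first | rfl | (rw [mul_of_le_one (by omega)]; rfl) | (rw [mul_add_two]; omega)

theorem Bounded.op (h : Bounded c t) : Bounded c t.op where
  ab := h.ba
  ba := h.ab
  bb := h.bb
  exists_one := or_left_comm.mp h.exists_one
  aab := h.baa
  baa := h.aab
  az := h.za
  za := h.az
  zb := h.bz
  bz := h.zb
  zz := h.zz

theorem Good.op (h : Good c t) : Good c t.op where
  toBounded := h.toBounded.op
  assoc x y z hx hy hz := by
    simp only [mul_op]
    exact (h.assoc z y x hz hy hx).symm

/-- The tables with `z = b ^ 2`, where `a * b` and `b * a` are powers of `a`. -/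
def tabC (c p q m : ℕ) : Tab :=
  { ab := p, aab := min (p + 1) (c + 2), ba := q, baa := min (q + 1) (c + 2), bb := 1,
    az := min (2 * p - 2) (c + 2), za := min (2 * q - 2) (c + 2), zb := m, bz := m,
    zz := min (m + q - 2) (c + 2) }

/-- The parameters for which `tabC` is associative. -/
def CondC (c p q m : ℕ) : Prop :=
  (3 ≤ p ∧ p ≤ c + 2) ∧ (3 ≤ q ∧ q ≤ c + 2) ∧ (4 ≤ m ∧ m ≤ c + 2) ∧
    (p = q ∨ c + 1 ≤ p ∧ c + 1 ≤ q) ∧ (m + 5 = 3 * p ∨ c + 1 ≤ m ∧ c + 6 ≤ 3 * p)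

/-- The tables with `z = a * b = b * a`. -/
def tabAB (c k r : ℕ) : Tab :=
  { ab := 1, aab := k, ba := 1, baa := k, bb := r, az := k, za := k,
    zb := if r = 1 then k else min (r + 1) (c + 2),
    bz := if r = 1 then k else min (r + 1) (c + 2),
    zz := if r = 1 then min (k + 1) (c + 2) else min (r + 2) (c + 2) }

/-- The parameters for which `tabAB` is associative. -/
def CondAB (c k r : ℕ) : Prop :=
  (4 ≤ k ∧ k ≤ c + 2) ∧ (r = 1 ∧ (k = 4 ∨ c + 1 ≤ k) ∨
    (3 ≤ r ∧ r ≤ c + 2) ∧ (r + 5 = 2 * k ∨ c ≤ r ∧ c + 5 ≤ 2 * k))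

/-- The tables with `z = a * b`, where `b * a` is a power of `a`. -/
def tabA (c q k r : ℕ) : Tab :=
  { ab := 1, aab := k, ba := q, baa := min (q + 1) (c + 2), bb := r, az := k,
    za := min (q + 1) (c + 2),
    zb := if r = 1 then k else min (r + 1) (c + 2),
    bz := if r = 1 then k else min (r + 1) (c + 2),
    zz := if r = 1 then min (k + 1) (c + 2) else min (r + 2) (c + 2) }

/-- The parameters for which `tabA` is associative. -/
def CondA (c q k r : ℕ) : Prop :=
  (3 ≤ q ∧ q ≤ c + 2) ∧ (4 ≤ k ∧ k ≤ c + 2) ∧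
    (r = 1 ∧ (q = 3 ∧ k = 4 ∨ c + 1 ≤ q ∧ k = c + 2) ∨
      (3 ≤ r ∧ r ≤ c + 2) ∧ (k = q + 1 ∨ c + 1 ≤ k ∧ c ≤ q) ∧
        (r + 3 = 2 * q ∨ c + 1 ≤ r ∧ c + 4 ≤ 2 * q))

theorem good_tabC (hc : 4 ≤ c) {p q m : ℕ} (h : CondC c p q m) : Good c (tabC c p q m) := by
  obtain ⟨hp, hq, hm, hpq, hpm⟩ := h
  -- With a generator in the middle, the outer factors matter only through being `b`, `z`, `a` or a
  -- higher power of `a`, which leaves finitely many inequalities between capped sums.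
  have key : ∀ x y z, (y = 0 ∨ y = 2) → x ≤ c + 2 → z ≤ c + 2 →
      mul c (tabC c p q m) (mul c (tabC c p q m) x y) z =
        mul c (tabC c p q m) x (mul c (tabC c p q m) y z) := by
    intro x y z hy hx hz
    have hx : x = 0 ∨ x = 1 ∨ x = 2 ∨ 3 ≤ x := by omega
    have hz : z = 0 ∨ z = 1 ∨ z = 2 ∨ 3 ≤ z := by omega
    rcases hy with rfl | rfl <;> rcases hx with rfl | rfl | rfl | hx <;>
      rcases hz with rfl | rfl | rfl | hz <;>
      simp (disch := omega) only [mul_zero_of_le, mul_of_le_zero, mul_one_of_le, mul_of_le_one,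
        mul_of_le_of_le, mul_zero_zero, mul_zero_one, mul_zero_two, mul_one_zero, mul_two_zero,
        mul_one_one, tabC, min_min_add] <;> grind
  refine good_of_generators ?_ (fun x z => key x 0 z (Or.inl rfl))
    (fun x z => key x 2 z (Or.inr rfl))
  constructor <;> simp only [tabC, or_true, true_or] <;> omega

theorem good_tabAB (hc : 4 ≤ c) {k r : ℕ} (h : CondAB c k r) : Good c (tabAB c k r) := by
  obtain ⟨hk, ⟨rfl, hr⟩ | ⟨hr, hr'⟩⟩ := h
  · have key : ∀ x y z, (y = 0 ∨ y = 2) → x ≤ c + 2 → z ≤ c + 2 →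
        mul c (tabAB c k 1) (mul c (tabAB c k 1) x y) z =
          mul c (tabAB c k 1) x (mul c (tabAB c k 1) y z) := by
      intro x y z hy hx hz
      have hx : x = 0 ∨ x = 1 ∨ x = 2 ∨ 3 ≤ x := by omega
      have hz : z = 0 ∨ z = 1 ∨ z = 2 ∨ 3 ≤ z := by omega
      rcases hy with rfl | rfl <;> rcases hx with rfl | rfl | rfl | hx <;>
        rcases hz with rfl | rfl | rfl | hz <;>
        simp (disch := omega) only [mul_zero_of_le, mul_of_le_zero, mul_one_of_le, mul_of_le_one,
          mul_of_le_of_le, mul_zero_zero, mul_zero_one, mul_zero_two, mul_one_zero, mul_two_zero,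
          mul_one_one, tabAB, if_true] <;> grind
    refine good_of_generators ?_ (fun x z => key x 0 z (Or.inl rfl))
      (fun x z => key x 2 z (Or.inr rfl))
    constructor <;> simp only [tabAB, if_true, or_true, true_or] <;> omega
  · have hr1 : r ≠ 1 := by omega
    have key : ∀ x y z, (y = 0 ∨ y = 2) → x ≤ c + 2 → z ≤ c + 2 →
        mul c (tabAB c k r) (mul c (tabAB c k r) x y) z =
          mul c (tabAB c k r) x (mul c (tabAB c k r) y z) := by
      intro x y z hy hx hz
      have hx : x = 0 ∨ x = 1 ∨ x = 2 ∨ 3 ≤ x := by omega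
      have hz : z = 0 ∨ z = 1 ∨ z = 2 ∨ 3 ≤ z := by omega
      rcases hy with rfl | rfl <;> rcases hx with rfl | rfl | rfl | hx <;>
        rcases hz with rfl | rfl | rfl | hz <;>
        simp (disch := omega) only [mul_zero_of_le, mul_of_le_zero, mul_one_of_le, mul_of_le_one,
          mul_of_le_of_le, mul_zero_zero, mul_zero_one, mul_zero_two, mul_one_zero, mul_two_zero,
          mul_one_one, tabAB, if_neg] <;> grind
    refine good_of_generators ?_ (fun x z => key x 0 z (Or.inl rfl))
      (fun x z => key x 2 z (Or.inr rfl))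
    constructor <;> simp only [tabAB, if_neg hr1, true_or] <;> omega

theorem good_tabA (hc : 4 ≤ c) {q k r : ℕ} (h : CondA c q k r) : Good c (tabA c q k r) := by
  obtain ⟨hq, hk, ⟨rfl, hr⟩ | ⟨hr, hkq, hrq⟩⟩ := h
  · have key : ∀ x y z, (y = 0 ∨ y = 2) → x ≤ c + 2 → z ≤ c + 2 →
        mul c (tabA c q k 1) (mul c (tabA c q k 1) x y) z =
          mul c (tabA c q k 1) x (mul c (tabA c q k 1) y z) := by
      intro x y z hy hx hz
      have hx : x = 0 ∨ x = 1 ∨ x = 2 ∨ 3 ≤ x := by omega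
      have hz : z = 0 ∨ z = 1 ∨ z = 2 ∨ 3 ≤ z := by omega
      rcases hy with rfl | rfl <;> rcases hx with rfl | rfl | rfl | hx <;>
        rcases hz with rfl | rfl | rfl | hz <;>
        simp (disch := omega) only [mul_zero_of_le, mul_of_le_zero, mul_one_of_le, mul_of_le_one,
          mul_of_le_of_le, mul_zero_zero, mul_zero_one, mul_zero_two, mul_one_zero, mul_two_zero,
          mul_one_one, tabA, min_min_add, if_true] <;> grind
    refine good_of_generators ?_ (fun x z => key x 0 z (Or.inl rfl))
      (fun x z => key x 2 z (Or.inr rfl))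
    constructor <;> simp only [tabA, if_true, or_true, true_or] <;> omega
  · have hr1 : r ≠ 1 := by omega
    have key : ∀ x y z, (y = 0 ∨ y = 2) → x ≤ c + 2 → z ≤ c + 2 →
        mul c (tabA c q k r) (mul c (tabA c q k r) x y) z =
          mul c (tabA c q k r) x (mul c (tabA c q k r) y z) := by
      intro x y z hy hx hz
      have hx : x = 0 ∨ x = 1 ∨ x = 2 ∨ 3 ≤ x := by omega
      have hz : z = 0 ∨ z = 1 ∨ z = 2 ∨ 3 ≤ z := by omega
      rcases hy with rfl | rfl <;> rcases hx with rfl | rfl | rfl | hx <;>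
        rcases hz with rfl | rfl | rfl | hz <;>
        simp (disch := omega) only [mul_zero_of_le, mul_of_le_zero, mul_one_of_le, mul_of_le_one,
          mul_of_le_of_le, mul_zero_zero, mul_zero_one, mul_zero_two, mul_one_zero, mul_two_zero,
          mul_one_one, tabA, min_min_add, if_neg] <;> grind
    refine good_of_generators ?_ (fun x z => key x 0 z (Or.inl rfl))
      (fun x z => key x 2 z (Or.inr rfl))
    constructor <;> simp only [tabA, if_neg hr1, true_or] <;> omega

set_option linter.unusedSimpArgs false

theorem exists_tabC (hc : 4 ≤ c) (h : Good c t) (hp : 3 ≤ t.ab) (hq : 3 ≤ t.ba) (hr : t.bb = 1) :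
    ∃ p q m, CondC c p q m ∧ t = tabC c p q m := by
  have bp := h.ab
  have bq := h.ba
  have := h.zb
  have := h.bz
  -- Codes `0`, `1`, `2` are `b`, `z`, `a`. The triple `a, b, a` links `p` and `q`; the triple `a,
  -- b, z` computes `a * b ^ 3` twice and gives `m + 1 = 3 * p - 4` up to the cap. The other triples
  -- determine the dependent entries.
  have e1 := h.assoc 2 2 0 (by omega) (by omega) (by omega)
  have e2 := h.assoc 0 2 2 (by omega) (by omega) (by omega)
  have e3 := h.assoc 2 0 2 (by omega) (by omega) (by omega)
  have e4 := h.assoc 2 0 0 (by omega) (by omega) (by omega)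
  have e5 := h.assoc 0 0 2 (by omega) (by omega) (by omega)
  have e6 := h.assoc 0 0 0 (by omega) (by omega) (by omega)
  have e7 := h.assoc 0 0 1 (by omega) (by omega) (by omega)
  have e8 := h.assoc 2 0 1 (by omega) (by omega) (by omega)
  simp (disch := omega) only [mul_zero_of_le, mul_of_le_zero, mul_one_of_le, mul_of_le_one,
    mul_of_le_of_le, mul_zero_zero, mul_zero_one, mul_zero_two, mul_one_zero, mul_two_zero,
    mul_one_one, hr] at e1 e2 e3 e4 e5 e6 e7 e8
  have b1 := h.aab
  have b2 := h.baa
  have b3 := h.az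
  have b4 := h.za
  refine ⟨t.ab, t.ba, t.zb, ⟨by grind, by grind, by grind, by grind, by grind⟩, ?_⟩
  ext <;> simp only [tabC] <;> grind

theorem exists_tabAB (hc : 4 ≤ c) (h : Good c t) (hp : t.ab = 1) (hq : t.ba = 1) :
    ∃ k r, CondAB c k r ∧ t = tabAB c k r := by
  have br := h.bb
  have := h.zb
  have := h.bz
  have b1 := h.aab
  have b2 := h.baa
  have b3 := h.az
  have b4 := h.za
  have e1 := h.assoc 2 2 0 (by omega) (by omega) (by omega)
  have e2 := h.assoc 0 2 2 (by omega) (by omega) (by omega)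
  have e3 := h.assoc 2 0 2 (by omega) (by omega) (by omega)
  have e4 := h.assoc 2 0 0 (by omega) (by omega) (by omega)
  have e5 := h.assoc 0 0 2 (by omega) (by omega) (by omega)
  have e6 := h.assoc 2 0 1 (by omega) (by omega) (by omega)
  simp (disch := omega) only [mul_zero_of_le, mul_of_le_zero, mul_one_of_le, mul_of_le_one,
    mul_of_le_of_le, mul_zero_zero, mul_zero_one, mul_zero_two, mul_one_zero, mul_two_zero,
    mul_one_one, hp, hq] at e1 e2 e3 e4 e5 e6
  rcases br with hr | hr
  -- Here `b * b = z`, and `b * z * a` yields `k + 1 = 2 * k - 3` up to the cap.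
  · have e7 := h.assoc 0 1 2 (by omega) (by omega) (by omega)
    have e8 := h.assoc 0 0 0 (by omega) (by omega) (by omega)
    simp (disch := omega) only [mul_zero_of_le, mul_of_le_zero, mul_one_of_le, mul_of_le_one,
      mul_of_le_of_le, mul_zero_zero, mul_zero_one, mul_zero_two, mul_one_zero, mul_two_zero,
      mul_one_one, hp, hq, hr] at e4 e5 e7 e8
    refine ⟨t.az, t.bb, ⟨by grind, by grind⟩, ?_⟩
    ext <;> simp only [tabAB, if_pos hr] <;> grind
  -- Here `b * b` is a power of `a`, and `a ^ 2 * b * b` yields `2 * k - 3 = r + 2` up to the cap.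
  · have e7 := h.assoc 3 0 0 (by omega) (by omega) (by omega)
    simp (disch := omega) only [mul_zero_of_le, mul_of_le_zero, mul_one_of_le, mul_of_le_one,
      mul_of_le_of_le, mul_zero_zero, mul_zero_one, mul_zero_two, mul_one_zero, mul_two_zero,
      mul_one_one, hp, hq] at e4 e5 e7
    have hr1 : t.bb ≠ 1 := by omega
    refine ⟨t.az, t.bb, ⟨by grind, by grind⟩, ?_⟩
    ext <;> simp only [tabAB, if_neg hr1] <;> grind

theorem exists_tabA (hc : 4 ≤ c) (h : Good c t) (hp : t.ab = 1) (hq : 3 ≤ t.ba) :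
    ∃ q k r, CondA c q k r ∧ t = tabA c q k r := by
  have bq := h.ba
  have br := h.bb
  have := h.zb
  have := h.bz
  have b1 := h.aab
  have b2 := h.baa
  have b3 := h.az
  have b4 := h.za
  have e1 := h.assoc 2 2 0 (by omega) (by omega) (by omega)
  have e2 := h.assoc 0 2 2 (by omega) (by omega) (by omega)
  have e3 := h.assoc 2 0 2 (by omega) (by omega) (by omega)
  have e4 := h.assoc 2 0 0 (by omega) (by omega) (by omega)
  have e5 := h.assoc 0 0 2 (by omega) (by omega) (by omega)
  have e6 := h.assoc 2 0 1 (by omega) (by omega) (by omega)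
  -- The product `a ^ 2 * b * a` links `k` to `q`, while `b * b * a` above links `r` to `q`.
  have e7 := h.assoc 3 0 2 (by omega) (by omega) (by omega)
  have e8 := h.assoc 0 2 0 (by omega) (by omega) (by omega)
  simp (disch := omega) only [mul_zero_of_le, mul_of_le_zero, mul_one_of_le, mul_of_le_one,
    mul_of_le_of_le, mul_zero_zero, mul_zero_one, mul_zero_two, mul_one_zero, mul_two_zero,
    mul_one_one, hp] at e1 e2 e3 e4 e5 e6 e7 e8
  rcases br with hr | hr
  · have e9 := h.assoc 0 0 0 (by omega) (by omega) (by omega)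
    simp (disch := omega) only [mul_zero_of_le, mul_of_le_zero, mul_one_of_le, mul_of_le_one,
      mul_of_le_of_le, mul_zero_zero, mul_zero_one, mul_zero_two, mul_one_zero, mul_two_zero,
      mul_one_one, hp, hr] at e4 e5 e9
    refine ⟨t.ba, t.az, t.bb, ⟨by grind, by grind, by grind⟩, ?_⟩
    ext <;> simp only [tabA, if_pos hr] <;> grind
  · simp (disch := omega) only [mul_zero_of_le, mul_of_le_zero, mul_one_of_le, mul_of_le_one,
      mul_of_le_of_le, mul_zero_zero, mul_zero_one, mul_zero_two, mul_one_zero, mul_two_zero,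
      mul_one_one, hp] at e4 e5
    have hr1 : t.bb ≠ 1 := by omega
    refine ⟨t.ba, t.az, t.bb, ⟨by grind, by grind, by grind⟩, ?_⟩
    ext <;> simp only [tabA, if_neg hr1] <;> grind

/-- Sort by whether `a * b` and `b * a` equal `z`. If neither does, `b * b` must; if only `b * a`
does, pass to the opposite table. -/
theorem good_cases (hc : 4 ≤ c) (h : Good c t) :
    (∃ p q m, CondC c p q m ∧ t = tabC c p q m) ∨ (∃ k r, CondAB c k r ∧ t = tabAB c k r) ∨
      (∃ q k r, CondA c q k r ∧ t = tabA c q k r) ∨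
      ∃ q k r, CondA c q k r ∧ t = (tabA c q k r).op := by
  rcases h.ab with hp | hp <;> rcases h.ba with hq | hq
  · exact Or.inr (Or.inl (exists_tabAB hc h hp hq))
  · exact Or.inr (Or.inr (Or.inl (exists_tabA hc h hp hq.1)))
  · obtain ⟨q, k, r, hcond, he⟩ := exists_tabA hc h.op hq hp.1
    exact Or.inr (Or.inr (Or.inr ⟨q, k, r, hcond, by rw [← he, op_op]⟩))
  · have := h.exists_one
    exact Or.inl (exists_tabC hc h hp.1 hq.1 (by omega))

end Tab

/-! ### Isomorphisms between table semigroups -/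

theorem map_mem_powSucc {S T : Type*} [Semigroup S] [Semigroup T] (e : S ≃* T) {k : ℕ} {x : S}
    (hx : x ∈ powSucc S k) : e x ∈ powSucc T k := by
  induction k generalizing x with
  | zero => trivial
  | succ k ih =>
    obtain ⟨u, hu, v, -, rfl⟩ := hx
    rw [map_mul]
    exact Set.mul_mem_mul (ih hu) trivial

theorem map_mem_powSucc_iff {S T : Type*} [Semigroup S] [Semigroup T] (e : S ≃* T) {k : ℕ} {x : S} :
    e x ∈ powSucc T k ↔ x ∈ powSucc S k :=
  ⟨fun h => by simpa using map_mem_powSucc e.symm h, map_mem_powSucc e⟩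

namespace Tab

variable {c : ℕ} {t t' : Tab}

theorem eq_of_mul_eq (h : Bounded c t) (h' : Bounded c t') (hc : 4 ≤ c)
    (hmul : ∀ i j, i ≤ c + 2 → j ≤ c + 2 → mul c t i j = mul c t' i j) : t = t' := by
  have := h.aab; have := h.baa; have := h.az; have := h.za
  have := h'.aab; have := h'.baa; have := h'.az; have := h'.za
  ext
  · exact hmul 2 0 (by omega) (by omega)
  · have := hmul 3 0 (by omega) (by omega)
    rw [mul_of_le_zero le_rfl, mul_of_le_zero le_rfl] at this
    omega
  · exact hmul 0 2 (by omega) (by omega)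
  · have := hmul 0 3 (by omega) (by omega)
    rw [mul_zero_of_le le_rfl, mul_zero_of_le le_rfl] at this
    omega
  · exact hmul 0 0 (by omega) (by omega)
  · have := hmul 2 1 (by omega) (by omega)
    rw [mul_of_le_one le_rfl, mul_of_le_one le_rfl] at this
    omega
  · have := hmul 1 2 (by omega) (by omega)
    rw [mul_one_of_le le_rfl, mul_one_of_le le_rfl] at this
    omega
  · exact hmul 1 0 (by omega) (by omega)
  · exact hmul 0 1 (by omega) (by omega)
  · exact hmul 1 1 (by omega) (by omega)

/-- The isomorphisms of table semigroups on the level of codes. -/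
theorem exists_code_map {h : Good c t} {h' : Good c t'}
    (e : Carrier (semigroup h) ≃* Carrier (semigroup h')) :
    ∃ f : ℕ → ℕ, (∀ x, code (e x) = f (code x)) ∧
      (∀ i j, i ≤ c + 2 → j ≤ c + 2 → f (mul c t i j) = mul c t' (f i) (f j)) ∧
      (∀ i j, i ≤ c + 2 → j ≤ c + 2 → f i = f j → i = j) ∧ ∀ i, i ≤ c + 2 → f i ≤ c + 2 := by
  classical
  let f : ℕ → ℕ := fun i =>
    if hi : i ≤ c + 2 then code (e (⟨i, Nat.lt_succ_of_le hi⟩ : Fin (c + 3))) else 0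
  have hf : ∀ x, code (e x) = f (code x) := fun x => by
    have := code_le x
    simp only [f, dif_pos this]
    rfl
  refine ⟨f, hf, ?_, ?_, ?_⟩
  · intro i j hi hj
    obtain ⟨x, rfl⟩ := exists_code_eq (s := semigroup h) hi
    obtain ⟨y, rfl⟩ := exists_code_eq (s := semigroup h) hj
    rw [← code_mul, ← hf, map_mul, code_mul, hf, hf]
  · intro i j hi hj hij
    obtain ⟨x, rfl⟩ := exists_code_eq (s := semigroup h) hi
    obtain ⟨y, rfl⟩ := exists_code_eq (s := semigroup h) hj
    rw [← hf, ← hf] at hij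
    rw [e.injective (code_injective hij)]
  · intro i hi
    obtain ⟨x, rfl⟩ := exists_code_eq (s := semigroup h) hi
    rw [← hf]
    exact code_le _

/-- Fixing `a` fixes all its powers; with `b` fixed too, injectivity leaves `z` no other image, so
the map is the identity on codes. -/
theorem eq_of_code_map_fix (h : Good c t) (h' : Good c t') (hc : 4 ≤ c) {f : ℕ → ℕ}
    (hmul : ∀ i j, i ≤ c + 2 → j ≤ c + 2 → f (mul c t i j) = mul c t' (f i) (f j))
    (hinj : ∀ i j, i ≤ c + 2 → j ≤ c + 2 → f i = f j → i = j)
    (hle : ∀ i, i ≤ c + 2 → f i ≤ c + 2) (h0 : f 0 = 0) (h2 : f 2 = 2) : t = t' := by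
  have hpow : ∀ i, i + 2 ≤ c + 2 → f (i + 2) = i + 2 := by
    intro i
    induction i with
    | zero => exact fun _ => h2
    | succ i ih =>
      intro hi
      have := hmul 2 (i + 2) (by omega) (by omega)
      rw [h2, ih (by omega), mul_of_le_of_le le_rfl (by omega),
        mul_of_le_of_le le_rfl (by omega)] at this
      rwa [show min (2 + (i + 2) - 1) (c + 2) = i + 1 + 2 by omega] at this
  have h1 : f 1 = 1 := by
    have h1le := hle 1 (by omega)
    by_contra hne
    have : f (f 1) = f 1 := by
      by_cases hz : f 1 = 0
      · rw [hz, h0]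
      · obtain ⟨i, hi⟩ : ∃ i, f 1 = i + 2 := ⟨f 1 - 2, by omega⟩
        rw [hi] at h1le ⊢
        exact hpow i h1le
    exact hne (hinj _ _ h1le (by omega) this)
  have hid : ∀ i, i ≤ c + 2 → f i = i := by
    intro i hi
    match i with
    | 0 => exact h0
    | 1 => exact h1
    | i + 2 => exact hpow i hi
  refine eq_of_mul_eq h.toBounded h'.toBounded hc fun i j hi hj => ?_
  have := hmul i j hi hj
  rwa [hid i hi, hid j hj, hid _ (mul_le h.toBounded i j)] at this

theorem code_map_generators {h : Good c t} {h' : Good c t'} (hc : 4 ≤ c)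
    (e : Carrier (semigroup h) ≃* Carrier (semigroup h')) (x : Carrier (semigroup h))
    (hx : code x = 0 ∨ code x = 2) : code (e x) = 0 ∨ code (e x) = 2 := by
  have h1 := (map_mem_powSucc_iff e (k := 1) (x := x)).not
  rw [mem_powSucc_one h hc, mem_powSucc_one h' hc] at h1
  omega

/-- An isomorphism preserves the layer `S ^ 3 \ S ^ 4`, whose only code is `4`. The image of `b ^ 3`
is `a ^ 3`, which lies in it. -/
theorem cube_eq_of_swap {h : Good c t} {h' : Good c t'} (hc : 4 ≤ c)
    (e : Carrier (semigroup h) ≃* Carrier (semigroup h')) (x : Carrier (semigroup h))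
    (hx : code x = 0) (hex : code (e x) = 2) : mul c t t.bb 0 = 4 := by
  have h2 := (map_mem_powSucc_iff e (k := 2) (x := x * x * x))
  have h3 := (map_mem_powSucc_iff e (k := 3) (x := x * x * x)).not
  rw [mem_powSucc_add_two h hc 0, mem_powSucc_add_two h' hc 0] at h2
  rw [mem_powSucc_add_two h hc 1, mem_powSucc_add_two h' hc 1] at h3
  have hl : code (x * x * x) = mul c t t.bb 0 := by rw [code_mul, code_mul, hx]; rfl
  have hr : code (e (x * x * x)) = 4 := by
    rw [map_mul, map_mul, code_mul, code_mul, hex, mul_of_le_of_le le_rfl le_rfl,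
      mul_of_le_of_le (by omega) le_rfl]
    omega
  rw [hl, hr] at h2 h3
  omega

theorem cases_of_cube_eq (hc : 4 ≤ c) (h : Good c t) (hb : mul c t t.bb 0 = 4) :
    t = tabC c 3 3 4 ∨ t = tabAB c 4 1 ∨ t = tabAB c 4 3 ∨ t = tabA c 3 4 1 ∨ t = tabA c 3 4 3 ∨
      t = (tabA c 3 4 1).op ∨ t = (tabA c 3 4 3).op := by
  rcases good_cases hc h with ⟨p, q, m, hcond, rfl⟩ | ⟨k, r, hcond, rfl⟩ | ⟨q, k, r, hcond, rfl⟩ |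
    ⟨q, k, r, hcond, rfl⟩
  · obtain ⟨hp, hq, hm, hpq, hpm⟩ := hcond
    have hm4 : m = 4 := hb
    obtain rfl : p = 3 := by omega
    obtain rfl : q = 3 := by omega
    exact Or.inl (by rw [hm4])
  · obtain ⟨hk, ⟨rfl, hr⟩ | ⟨hr, hr'⟩⟩ := hcond
    · have hk4 : k = 4 := hb
      simp [hk4]
    · change mul c _ r 0 = 4 at hb
      rw [mul_of_le_zero hr.1] at hb
      change min (k + (r - 3)) (c + 2) = 4 at hb
      obtain rfl : k = 4 := by omega
      obtain rfl : r = 3 := by omega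
      simp
  · obtain ⟨hq, hk, ⟨rfl, hr⟩ | ⟨hr, hkq, hrq⟩⟩ := hcond
    · have hk4 : k = 4 := hb
      obtain rfl : q = 3 := by omega
      simp [hk4]
    · change mul c _ r 0 = 4 at hb
      rw [mul_of_le_zero hr.1] at hb
      change min (k + (r - 3)) (c + 2) = 4 at hb
      obtain rfl : k = 4 := by omega
      obtain rfl : r = 3 := by omega
      obtain rfl : q = 3 := by omega
      simp
  · obtain ⟨hq, hk, ⟨rfl, hr⟩ | ⟨hr, hkq, hrq⟩⟩ := hcond
    · have hk4 : k = 4 := hb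
      obtain rfl : q = 3 := by omega
      simp [hk4]
    · change mul c _ r 0 = 4 at hb
      rw [mul_of_le_zero hr.1] at hb
      change min (min (q + 1) (c + 2) + (r - 3)) (c + 2) = 4 at hb
      obtain rfl : q = 3 := by omega
      obtain rfl : r = 3 := by omega
      obtain rfl : k = 4 := by omega
      simp

/-- Isomorphic tables are equal, with two exceptional pairs, in which the isomorphism exchanges
the generators. -/
theorem eq_or_swap_of_mulEquiv {h : Good c t} {h' : Good c t'} (hc : 4 ≤ c)
    (e : Carrier (semigroup h) ≃* Carrier (semigroup h')) :
    t = t' ∨ (t = tabC c 3 3 4 ∧ t' = tabAB c 4 1) ∨ (t = tabAB c 4 1 ∧ t' = tabC c 3 3 4) ∨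
      (t = tabA c 3 4 3 ∧ t' = (tabA c 3 4 3).op) ∨
        (t = (tabA c 3 4 3).op ∧ t' = tabA c 3 4 3) := by
  obtain ⟨f, hf, hmul, hinj, hle⟩ := exists_code_map e
  obtain ⟨x0, hx0⟩ := exists_code_eq (s := semigroup h) (i := 0) (by omega)
  obtain ⟨x2, hx2⟩ := exists_code_eq (s := semigroup h) (i := 2) (by omega)
  have hg0 := code_map_generators hc e x0 (Or.inl hx0)
  have hg2 := code_map_generators hc e x2 (Or.inr hx2)
  have hne : f 0 ≠ f 2 := fun h => by
    have := hinj 0 2 (by omega) (by omega) h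
    omega
  rw [hf, hx0] at hg0
  rw [hf, hx2] at hg2
  by_cases h0 : f 0 = 0
  · exact Or.inl (eq_of_code_map_fix h h' hc hmul hinj hle h0 (by omega))
  have h0 : f 0 = 2 := by omega
  have h2 : f 2 = 0 := by omega
  have ht := cases_of_cube_eq hc h (cube_eq_of_swap hc e x0 hx0 (by rw [hf, hx0, h0]))
  have ht' := cases_of_cube_eq hc h' (cube_eq_of_swap hc e.symm (e x2) (by rw [hf, hx2, h2])
    (by rw [e.symm_apply_apply, hx2]))
  have haa := hmul 2 2 (by omega) (by omega)
  have hab := hmul 2 0 (by omega) (by omega)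
  have hba := hmul 0 2 (by omega) (by omega)
  have hbb := hmul 0 0 (by omega) (by omega)
  rw [h2, mul_of_le_of_le le_rfl le_rfl, mul_zero_zero,
    show min (2 + 2 - 1) (c + 2) = 3 by omega] at haa
  rw [h2, h0, mul_two_zero, mul_zero_two] at hab
  rw [h2, h0, mul_two_zero, mul_zero_two] at hba
  rw [h0, mul_of_le_of_le le_rfl le_rfl, mul_zero_zero,
    show min (2 + 2 - 1) (c + 2) = 3 by omega] at hbb
  -- The four products of generators, together with `f 1 ≠ f 3`, rule out all pairs except equal
  -- tables and the two exceptional pairs.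
  have h31 : f 1 ≠ f 3 := fun h => by
    have := hinj 1 3 (by omega) (by omega) h
    omega
  rcases ht with rfl | rfl | rfl | rfl | rfl | rfl | rfl <;>
    rcases ht' with rfl | rfl | rfl | rfl | rfl | rfl | rfl <;>
    simp only [tabC, tabAB, tabA, op] at haa hab hba hbb <;>
    first
    | exact Or.inl rfl
    | exact Or.inr (Or.inl ⟨rfl, rfl⟩)
    | exact Or.inr (Or.inr (Or.inl ⟨rfl, rfl⟩))
    | exact Or.inr (Or.inr (Or.inr (Or.inl ⟨rfl, rfl⟩)))
    | exact Or.inr (Or.inr (Or.inr (Or.inr ⟨rfl, rfl⟩)))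
    | omega

theorem mulEquiv_of_involution (h : Good c t) (h' : Good c t') (σ : ℕ → ℕ)
    (hσ : ∀ x, σ (σ x) = x) (hle : ∀ x, x ≤ c + 2 → σ x ≤ c + 2)
    (hmul : ∀ x y, x ≤ c + 2 → y ≤ c + 2 → σ (mul c t x y) = mul c t' (σ x) (σ y)) :
    Nonempty (Carrier (semigroup h) ≃* Carrier (semigroup h')) := by
  let g : Fin (c + 3) → Fin (c + 3) := fun x =>
    ⟨σ x, Nat.lt_succ_of_le (hle x (Nat.le_of_lt_succ x.2))⟩
  have hg : ∀ x, g (g x) = x := fun x => Fin.ext (hσ x)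
  exact ⟨{ toFun := g
           invFun := g
           left_inv := hg
           right_inv := hg
           map_mul' := fun x y => Fin.ext (hmul (Fin.val x) (Fin.val y)
             (Nat.le_of_lt_succ x.2) (Nat.le_of_lt_succ y.2)) }⟩

theorem condC_three (hc : 4 ≤ c) : CondC c 3 3 4 := by
  unfold CondC
  omega

theorem condAB_four (hc : 4 ≤ c) : CondAB c 4 1 := by
  unfold CondAB
  omega

theorem condA_three (hc : 4 ≤ c) : CondA c 3 4 3 := by
  unfold CondA
  omega

/-- In the first table `a * b = b * a = b * b = z`. Exchanging `a` and `b` makes `z` the square of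
the new `a`, and the old `a ^ 2` the new `z`. -/
theorem mulEquiv_tabAB_tabC (hc : 4 ≤ c) : Nonempty
    (Carrier (semigroup (good_tabAB hc (condAB_four hc))) ≃*
      Carrier (semigroup (good_tabC hc (condC_three hc)))) := by
  refine mulEquiv_of_involution _ _
    (fun x => if x = 0 then 2 else if x = 2 then 0 else if x = 1 then 3 else if x = 3 then 1 else x)
    (by grind) (by grind) ?_
  intro x y hx hy
  have hx : x = 0 ∨ x = 1 ∨ x = 2 ∨ x = 3 ∨ 4 ≤ x := by omega
  have hy : y = 0 ∨ y = 1 ∨ y = 2 ∨ y = 3 ∨ 4 ≤ y := by omega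
  rcases hx with rfl | rfl | rfl | rfl | hx <;> rcases hy with rfl | rfl | rfl | rfl | hy <;>
    simp (disch := omega) [mul_zero_of_le, mul_of_le_zero, mul_one_of_le, mul_of_le_one,
      mul_of_le_of_le, mul_zero_zero, mul_zero_one, mul_zero_two, mul_one_zero, mul_two_zero,
      mul_one_one, tabAB, tabC, if_neg] <;> grind

/-- Here `a * a = b * b = b * a` and `z = a * b`, so exchanging `a` and `b` reverses the
multiplication. -/
theorem mulEquiv_op_tabA (hc : 4 ≤ c) : Nonempty
    (Carrier (semigroup (good_tabA hc (condA_three hc)).op) ≃*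
      Carrier (semigroup (good_tabA hc (condA_three hc)))) := by
  refine mulEquiv_of_involution _ _
    (fun x => if x = 0 then 2 else if x = 2 then 0 else x) (by grind) (by grind) ?_
  intro x y hx hy
  have hx : x = 0 ∨ x = 1 ∨ x = 2 ∨ x = 3 ∨ 4 ≤ x := by omega
  have hy : y = 0 ∨ y = 1 ∨ y = 2 ∨ y = 3 ∨ 4 ≤ y := by omega
  rcases hx with rfl | rfl | rfl | rfl | hx <;> rcases hy with rfl | rfl | rfl | rfl | hy <;>
    simp (disch := omega) [mul_zero_of_le, mul_of_le_zero, mul_one_of_le, mul_of_le_one,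
      mul_of_le_of_le, mul_zero_zero, mul_zero_one, mul_zero_two, mul_one_zero, mul_two_zero,
      mul_one_one, tabA, op, if_neg] <;> grind

/-- The opposite of a table semigroup. -/
def opMulEquiv (h : Good c t) : (Carrier (semigroup h))ᵐᵒᵖ ≃* Carrier (semigroup h.op) where
  toFun x := MulOpposite.unop x
  invFun x := MulOpposite.op x
  left_inv _ := rfl
  right_inv _ := rfl
  map_mul' x y := code_injective (mul_op (code x.unop) (code y.unop)).symm

/-! ### Counting the parameters -/

open Finset

/-- The parameters `(p, m)` of the commutative tables `tabC c p p m`. -/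
def keysC (c : ℕ) : Finset (ℕ × ℕ) :=
  (Icc 3 ((c + 5) / 3)).image (fun p => (p, 3 * p - 5)) ∪
    Icc ((c + 5) / 3 + 1) (c + 2) ×ˢ Icc (c + 1) (c + 2)

/-- The parameters `(k, r)` of the tables `tabAB c k r`, up to `(4, 1)`. -/
def keysAB (c : ℕ) : Finset (ℕ × ℕ) :=
  Icc (c + 1) (c + 2) ×ˢ {1} ∪ ((Icc 4 ((c + 4) / 2)).image (fun k => (k, 2 * k - 5)) ∪
    Icc ((c + 4) / 2 + 1) (c + 2) ×ˢ Icc c (c + 2))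

/-- The parameters `(q, k, r)` of the tables `tabA c q k r`. -/
def keysA (c : ℕ) : Finset (ℕ × ℕ × ℕ) :=
  {(3, 4, 1), (c + 1, c + 2, 1), (c + 2, c + 2, 1)} ∪
    ((Icc 3 ((c + 3) / 2)).image (fun q => (q, q + 1, 2 * q - 3)) ∪
      ((Icc ((c + 3) / 2 + 1) (c - 1) ×ˢ Icc (c + 1) (c + 2)).image
          (fun x => (x.1, x.1 + 1, x.2)) ∪
        Icc c (c + 2) ×ˢ Icc (c + 1) (c + 2) ×ˢ Icc (c + 1) (c + 2)))

theorem mem_keysC (hc : 4 ≤ c) (p m : ℕ) : (p, m) ∈ keysC c ↔ CondC c p p m := by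
  simp only [keysC, CondC, mem_union, mem_image, mem_product, mem_Icc, Prod.mk.injEq, true_or,
    true_and]
  constructor
  · rintro (⟨q, hq, rfl, rfl⟩ | h) <;> omega
  · intro h
    -- For `3 * p ≤ c + 5` the value of `m` is forced; beyond that it may be `c + 1` or `c + 2`.
    by_cases hp : p ≤ (c + 5) / 3
    · exact Or.inl ⟨p, by omega, rfl, by omega⟩
    · exact Or.inr (by omega)

theorem mem_keysAB (hc : 4 ≤ c) (k r : ℕ) :
    (k, r) ∈ keysAB c ↔ CondAB c k r ∧ ¬ (k = 4 ∧ r = 1) := by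
  simp only [keysAB, CondAB, mem_union, mem_image, mem_product, mem_Icc, mem_singleton,
    Prod.mk.injEq]
  constructor
  · rintro (h | ⟨q, hq, rfl, rfl⟩ | h) <;> omega
  · intro h
    by_cases hr : r = 1
    · exact Or.inl (by omega)
    -- For `2 * k ≤ c + 4` the value of `r` is forced; beyond that three values remain.
    by_cases hk : k ≤ (c + 4) / 2
    · exact Or.inr (Or.inl ⟨k, by omega, rfl, by omega⟩)
    · exact Or.inr (Or.inr (by omega))

theorem mem_keysA (hc : 4 ≤ c) (q k r : ℕ) : (q, k, r) ∈ keysA c ↔ CondA c q k r := by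
  simp only [keysA, CondA, mem_union, mem_image, mem_product, mem_Icc, mem_singleton, mem_insert,
    Prod.mk.injEq, Prod.exists]
  constructor
  · rintro (h | ⟨q, hq, rfl, rfl, rfl⟩ | ⟨q, r, hq, rfl, rfl, rfl⟩ | h) <;> omega
  · intro h
    by_cases hr : r = 1
    · exact Or.inl (by omega)
    by_cases hq : q ≤ (c + 3) / 2
    · exact Or.inr (Or.inl ⟨q, by omega, rfl, by omega, by omega⟩)
    -- Below `c`, `k` is forced to be `q + 1`; from `c` on, `k` and `r` vary independently.
    by_cases hq' : q ≤ c - 1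
    · exact Or.inr (Or.inr (Or.inl ⟨q, r, by omega, rfl, by omega, rfl⟩))
    · exact Or.inr (Or.inr (Or.inr (by omega)))

theorem card_keysC (hc : 4 ≤ c) : #(keysC c) = 2 * c + 2 - (c + 5) / 3 := by
  have h2 : c + 2 + 1 - (c + 1) = 2 := by omega
  rw [keysC, card_union_of_disjoint, card_image_of_injective, card_product]
  · simp only [Nat.card_Icc, h2]
    omega
  · exact fun p q h => (Prod.mk.inj h).1
  · rw [disjoint_left]
    rintro ⟨p, m⟩ h
    simp only [mem_image, mem_product, mem_Icc, Prod.mk.injEq] at h ⊢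
    obtain ⟨q, hq, rfl, rfl⟩ := h
    omega

theorem card_keysAB (hc : 4 ≤ c) : #(keysAB c) = 3 * c + 5 - 2 * ((c + 4) / 2) := by
  have h2 : c + 2 + 1 - (c + 1) = 2 := by omega
  have h3 : c + 2 + 1 - c = 3 := by omega
  rw [keysAB, card_union_of_disjoint, card_union_of_disjoint, card_image_of_injective,
    card_product, card_product]
  · simp only [Nat.card_Icc, card_singleton, h2, h3]
    omega
  · exact fun p q h => (Prod.mk.inj h).1
  · rw [disjoint_left]
    rintro ⟨p, m⟩ h
    simp only [mem_image, mem_product, mem_Icc, Prod.mk.injEq] at h ⊢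
    obtain ⟨q, hq, rfl, rfl⟩ := h
    omega
  · rw [disjoint_left]
    rintro ⟨p, m⟩ h
    simp only [mem_image, mem_union, mem_product, mem_Icc, mem_singleton, Prod.mk.injEq] at h ⊢
    rintro (⟨q, hq, rfl, rfl⟩ | h') <;> omega

theorem card_keysA (hc : 4 ≤ c) : #(keysA c) = 2 * c + 11 - (c + 3) / 2 := by
  have h2 : c + 2 + 1 - (c + 1) = 2 := by omega
  have h3 : c + 2 + 1 - c = 3 := by omega
  rw [keysA, card_union_of_disjoint, card_union_of_disjoint, card_union_of_disjoint,
    card_image_of_injective, card_image_of_injective, card_product, card_product, card_product,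
    card_insert_of_notMem, card_insert_of_notMem, card_singleton]
  · simp only [Nat.card_Icc, h2, h3]
    omega
  · simp
  · simp
    omega
  · rintro ⟨p, m⟩ ⟨q, n⟩ h
    simp only [Prod.mk.injEq] at h ⊢
    exact ⟨h.1, h.2.2⟩
  · exact fun p q h => (Prod.mk.inj h).1
  · rw [disjoint_left]
    rintro ⟨p, m, r⟩ h
    simp only [mem_image, mem_product, mem_Icc, Prod.mk.injEq, Prod.exists] at h ⊢
    obtain ⟨q, hq, h1, h2, rfl, rfl⟩ := h
    omega
  · rw [disjoint_left]
    rintro ⟨p, m, r⟩ h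
    simp only [mem_image, mem_union, mem_product, mem_Icc, Prod.mk.injEq, Prod.exists] at h ⊢
    obtain ⟨q, hq, rfl, rfl, rfl⟩ := h
    rintro (⟨q', hq', h1, h2, h3, h4⟩ | h') <;> omega
  · rw [disjoint_left]
    rintro ⟨p, m, r⟩ h
    simp only [mem_image, mem_union, mem_product, mem_Icc, mem_singleton, mem_insert,
      Prod.mk.injEq, Prod.exists] at h ⊢
    rintro (⟨q', hq', h1, h2, h3⟩ | ⟨q', h1, h2, h3, h4, h5⟩ | h') <;> omega

/-- Representatives of the commutative semigroups. -/
def commReps (c : ℕ) : Finset Tab :=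
  (keysC c).image (fun x => tabC c x.1 x.1 x.2) ∪ (keysAB c).image (fun x => tabAB c x.1 x.2)

/-- Representatives up to isomorphism and anti-isomorphism. -/
def antiReps (c : ℕ) : Finset Tab :=
  commReps c ∪ ((Icc (c + 1) (c + 2)).image (tabC c (c + 1) (c + 2)) ∪
    (keysA c).image (fun x => tabA c x.1 x.2.1 x.2.2))

/-- Representatives up to isomorphism. -/
def isoReps (c : ℕ) : Finset Tab :=
  antiReps c ∪ ((Icc (c + 1) (c + 2)).image (tabC c (c + 2) (c + 1)) ∪
    ((keysA c).erase (3, 4, 3)).image (fun x => (tabA c x.1 x.2.1 x.2.2).op))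

theorem mem_commReps (hc : 4 ≤ c) : t ∈ commReps c ↔
    (∃ p m, CondC c p p m ∧ t = tabC c p p m) ∨
      ∃ k r, CondAB c k r ∧ ¬ (k = 4 ∧ r = 1) ∧ t = tabAB c k r := by
  simp only [commReps, mem_union, mem_image, Prod.exists, mem_keysC hc, mem_keysAB hc, and_assoc,
    eq_comm (b := t)]

theorem mem_antiReps (hc : 4 ≤ c) : t ∈ antiReps c ↔ t ∈ commReps c ∨
    (∃ m, CondC c (c + 1) (c + 2) m ∧ t = tabC c (c + 1) (c + 2) m) ∨
      ∃ q k r, CondA c q k r ∧ t = tabA c q k r := by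
  have hm : ∀ m, m ∈ Icc (c + 1) (c + 2) ↔ CondC c (c + 1) (c + 2) m := fun m => by
    simp only [mem_Icc, CondC]
    omega
  simp only [antiReps, mem_union, mem_image, Prod.exists, mem_keysA hc, hm, eq_comm (b := t)]

theorem mem_isoReps (hc : 4 ≤ c) : t ∈ isoReps c ↔ t ∈ antiReps c ∨
    (∃ m, CondC c (c + 2) (c + 1) m ∧ t = tabC c (c + 2) (c + 1) m) ∨
      ∃ q k r, CondA c q k r ∧ ¬ (q = 3 ∧ k = 4 ∧ r = 3) ∧ t = (tabA c q k r).op := by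
  have hm : ∀ m, m ∈ Icc (c + 1) (c + 2) ↔ CondC c (c + 2) (c + 1) m := fun m => by
    simp only [mem_Icc, CondC]
    omega
  simp only [isoReps, mem_union, mem_image, Prod.exists, mem_keysA hc, hm, mem_erase,
    eq_comm (b := t), ne_eq, Prod.mk.injEq, and_assoc,
    and_comm (b := CondA c _ _ _)]

theorem card_commReps (hc : 4 ≤ c) :
    #(commReps c) = 5 * c + 7 - (c + 5) / 3 - 2 * ((c + 4) / 2) := by
  rw [commReps, card_union_of_disjoint, card_image_of_injective, card_image_of_injective,
    card_keysC hc, card_keysAB hc]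
  · omega
  · rintro ⟨k, r⟩ ⟨k', r'⟩ h
    exact Prod.ext (congrArg aab h) (congrArg bb h)
  · rintro ⟨p, m⟩ ⟨p', m'⟩ h
    exact Prod.ext (congrArg ab h) (congrArg zb h)
  · rw [disjoint_left]
    intro t h h'
    simp only [mem_image, Prod.exists, mem_keysC hc, mem_keysAB hc] at h h'
    obtain ⟨p, m, hcond, rfl⟩ := h
    obtain ⟨k, r, -, h⟩ := h'
    have h1 : 1 = p := congrArg ab h
    have := hcond.1
    omega

theorem ab_eq_ba_of_mem_commReps (hc : 4 ≤ c) (h : t ∈ commReps c) : t.ab = t.ba := by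
  rcases (mem_commReps hc).mp h with ⟨p, m, -, rfl⟩ | ⟨k, r, -, -, rfl⟩ <;> rfl

theorem card_antiReps (hc : 4 ≤ c) :
    #(antiReps c) = 7 * c + 20 - (c + 5) / 3 - 2 * ((c + 4) / 2) - (c + 3) / 2 := by
  rw [antiReps, card_union_of_disjoint, card_union_of_disjoint, card_image_of_injective,
    card_image_of_injective, card_commReps hc, card_keysA hc, Nat.card_Icc]
  · omega
  · rintro ⟨q, k, r⟩ ⟨q', k', r'⟩ h
    exact Prod.ext (congrArg ba h) (Prod.ext (congrArg aab h) (congrArg bb h))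
  · exact fun m m' h => congrArg zb h
  · rw [disjoint_left]
    intro t h h'
    simp only [mem_image, Prod.exists] at h h'
    obtain ⟨m, -, rfl⟩ := h
    obtain ⟨q, k, r, -, h⟩ := h'
    have h1 : 1 = c + 1 := congrArg ab h
    omega
  · rw [disjoint_left]
    intro t h h'
    have h0 := ab_eq_ba_of_mem_commReps hc h
    simp only [mem_union, mem_image, Prod.exists, mem_keysA hc] at h'
    rcases h' with ⟨m, -, rfl⟩ | ⟨q, k, r, hcond, rfl⟩
    · simp [tabC] at h0
    · change 1 = q at h0
      have := hcond.1
      omega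

/-- This inequality orients each non-commutative table against its opposite; it separates the two
halves of `isoReps`. -/
theorem ab_le_ba_of_mem_antiReps (hc : 4 ≤ c) (h : t ∈ antiReps c) : t.ab ≤ t.ba := by
  rcases (mem_antiReps hc).mp h with h | ⟨m, -, rfl⟩ | ⟨q, k, r, hcond, rfl⟩
  · exact (ab_eq_ba_of_mem_commReps hc h).le
  · simp [tabC]
  · change 1 ≤ q
    have := hcond.1
    omega

theorem card_isoReps (hc : 4 ≤ c) :
    #(isoReps c) = 9 * c + 32 - (c + 5) / 3 - 2 * ((c + 4) / 2) - 2 * ((c + 3) / 2) := by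
  rw [isoReps, card_union_of_disjoint, card_union_of_disjoint, card_image_of_injective,
    card_image_of_injective, card_antiReps hc, card_erase_of_mem, card_keysA hc, Nat.card_Icc]
  · omega
  · exact (mem_keysA hc _ _ _).mpr (condA_three hc)
  · rintro ⟨q, k, r⟩ ⟨q', k', r'⟩ h
    exact Prod.ext (congrArg ab h) (Prod.ext (congrArg baa h) (congrArg bb h))
  · exact fun m m' h => congrArg zb h
  · rw [disjoint_left]
    intro t h h'
    simp only [mem_image, Prod.exists] at h h'
    obtain ⟨m, -, rfl⟩ := h
    obtain ⟨q, k, r, -, h⟩ := h'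
    have h1 : 1 = c + 1 := congrArg ba h
    omega
  · rw [disjoint_left]
    intro t h h'
    have h0 := ab_le_ba_of_mem_antiReps hc h
    simp only [mem_union, mem_image, Prod.exists, mem_erase, mem_keysA hc] at h'
    rcases h' with ⟨m, -, rfl⟩ | ⟨q, k, r, hcond, rfl⟩
    · simp [tabC] at h0
    · change q ≤ 1 at h0
      have := hcond.2.1
      omega

end Tab

/-! ### From representatives to the numbers of classes -/

open Finset

theorem countUpTo_eq_card {c : ℕ} (r : Setoid (Semigroup (Fin (c + 3))))
    (P : Semigroup (Fin (c + 3)) → Prop) (F : Finset Tab) (hgood : ∀ t ∈ F, Tab.Good c t)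
    (hP : ∀ t (h : t ∈ F), P (Tab.semigroup (hgood t h)))
    (hsurj : ∀ s, P s → ∃ t, ∃ h : t ∈ F, r (Tab.semigroup (hgood t h)) s)
    (hinj : ∀ t t' (h : t ∈ F) (h' : t' ∈ F),
      r (Tab.semigroup (hgood t h)) (Tab.semigroup (hgood t' h')) → t = t') :
    countUpTo r P = #F := by
  rw [countUpTo, ← Nat.card_eq_finsetCard F]
  symm
  refine Nat.card_eq_of_bijective
    (fun t : F => Quotient.mk (r.comap (Subtype.val : {s // P s} → _))
      ⟨Tab.semigroup (hgood t.1 t.2), hP t.1 t.2⟩) ⟨?_, ?_⟩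
  · intro t t' h
    exact Subtype.ext (hinj t.1 t'.1 t.2 t'.2 (Quotient.exact (s := r.comap Subtype.val) h))
  · intro q
    induction q using Quotient.ind with
    | _ s =>
      obtain ⟨t, h, hr⟩ := hsurj s.1 s.2
      exact ⟨⟨t, h⟩, Quotient.sound hr⟩

namespace Tab

variable {c : ℕ} {t t' : Tab}

theorem good_of_mem_isoReps (hc : 4 ≤ c) (h : t ∈ isoReps c) : Good c t := by
  rcases (mem_isoReps hc).mp h with h | ⟨m, hcond, rfl⟩ | ⟨q, k, r, hcond, -, rfl⟩
  · rcases (mem_antiReps hc).mp h with h | ⟨m, hcond, rfl⟩ | ⟨q, k, r, hcond, rfl⟩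
    · rcases (mem_commReps hc).mp h with ⟨p, m, hcond, rfl⟩ | ⟨k, r, hcond, -, rfl⟩
      · exact good_tabC hc hcond
      · exact good_tabAB hc hcond
    · exact good_tabC hc hcond
    · exact good_tabA hc hcond
  · exact good_tabC hc hcond
  · exact (good_tabA hc hcond).op

theorem antiReps_subset_isoReps (hc : 4 ≤ c) : antiReps c ⊆ isoReps c :=
  fun _ h => (mem_isoReps hc).mpr (Or.inl h)

theorem commReps_subset_antiReps (hc : 4 ≤ c) : commReps c ⊆ antiReps c :=
  fun _ h => (mem_antiReps hc).mpr (Or.inl h)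

/-- Every table is isomorphic to a representative. -/
theorem exists_mem_isoReps (hc : 4 ≤ c) (h : Good c t) :
    ∃ (t' : Tab) (h' : t' ∈ isoReps c),
      Nonempty (Carrier (semigroup (good_of_mem_isoReps hc h')) ≃* Carrier (semigroup h)) := by
  by_cases hmem : t ∈ isoReps c
  · exact ⟨t, hmem, ⟨MulEquiv.refl _⟩⟩
  have hanti : t ∉ antiReps c := fun h => hmem (antiReps_subset_isoReps hc h)
  have hcomm : t ∉ commReps c := fun h => hanti (commReps_subset_antiReps hc h)
  rw [mem_isoReps hc] at hmem
  rw [mem_antiReps hc] at hanti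
  rw [mem_commReps hc] at hcomm
  rcases good_cases hc h with ⟨p, q, m, hcond, rfl⟩ | ⟨k, r, hcond, rfl⟩ | ⟨q, k, r, hcond, rfl⟩ |
    ⟨q, k, r, hcond, rfl⟩
  · by_cases hpq : p = q
    · subst hpq
      exact absurd (Or.inl ⟨p, m, hcond, rfl⟩) hcomm
    -- A non-commutative `tabC` has `{p, q} = {c + 1, c + 2}`, the only room that the cap leaves.
    · obtain ⟨hp, hq, hm, h1, -⟩ := id hcond
      by_cases hp : p = c + 1
      · obtain rfl : q = c + 2 := by omega
        subst hp
        exact absurd (Or.inr (Or.inl ⟨m, hcond, rfl⟩)) hanti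
      · obtain rfl : q = c + 1 := by omega
        obtain rfl : p = c + 2 := by omega
        exact absurd (Or.inr (Or.inl ⟨m, hcond, rfl⟩)) hmem
  · by_cases hkr : k = 4 ∧ r = 1
    · obtain ⟨rfl, rfl⟩ := hkr
      have hC : tabC c 3 3 4 ∈ isoReps c := antiReps_subset_isoReps hc <|
        commReps_subset_antiReps hc <| (mem_commReps hc).mpr <|
          Or.inl ⟨3, 4, condC_three hc, rfl⟩
      obtain ⟨e⟩ := mulEquiv_tabAB_tabC hc
      exact ⟨_, hC, ⟨e.symm⟩⟩
    · exact absurd (Or.inr ⟨k, r, hcond, hkr, rfl⟩) hcomm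
  · exact absurd (Or.inr (Or.inr ⟨q, k, r, hcond, rfl⟩)) hanti
  · by_cases hqkr : q = 3 ∧ k = 4 ∧ r = 3
    · obtain ⟨rfl, rfl, rfl⟩ := hqkr
      have hA : tabA c 3 4 3 ∈ isoReps c := antiReps_subset_isoReps hc <|
        (mem_antiReps hc).mpr <| Or.inr <| Or.inr ⟨3, 4, 3, condA_three hc, rfl⟩
      obtain ⟨e⟩ := mulEquiv_op_tabA hc
      exact ⟨_, hA, ⟨e.symm⟩⟩
    · exact absurd (Or.inr (Or.inr ⟨q, k, r, hcond, hqkr, rfl⟩)) hmem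

theorem tabAB_four_notMem_isoReps (hc : 4 ≤ c) : tabAB c 4 1 ∉ isoReps c := by
  intro h
  rcases (mem_isoReps hc).mp h with h | ⟨m, -, h⟩ | ⟨q, k, r, hcond, -, h⟩
  · rcases (mem_antiReps hc).mp h with h | ⟨m, -, h⟩ | ⟨q, k, r, hcond, h⟩
    · rcases (mem_commReps hc).mp h with ⟨p, m, hcond, h⟩ | ⟨k, r, -, hne, h⟩
      · have h1 : 1 = p := congrArg ab h
        have := hcond.1
        omega
      · exact hne ⟨(congrArg aab h).symm, (congrArg bb h).symm⟩
    · have h1 : 1 = c + 1 := congrArg ab h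
      omega
    · have h1 : 1 = q := congrArg ba h
      have := hcond.1
      omega
  · have h1 : 1 = c + 2 := congrArg ab h
    omega
  · have h1 : 1 = q := congrArg ab h
    have := hcond.1
    omega

theorem op_tabA_three_notMem_antiReps (hc : 4 ≤ c) : (tabA c 3 4 3).op ∉ antiReps c := by
  intro h
  have h1 : 3 ≤ 1 := ab_le_ba_of_mem_antiReps hc h
  omega

theorem op_tabA_three_notMem_isoReps (hc : 4 ≤ c) : (tabA c 3 4 3).op ∉ isoReps c := by
  intro h
  rcases (mem_isoReps hc).mp h with h | ⟨m, -, h⟩ | ⟨q, k, r, -, hne, h⟩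
  · exact op_tabA_three_notMem_antiReps hc h
  · have h1 : 1 = c + 1 := congrArg ba h
    omega
  · exact hne ⟨(congrArg ab h).symm, (congrArg baa h).symm, (congrArg bb h).symm⟩

theorem eq_of_mem_isoReps (hc : 4 ≤ c) (h : t ∈ isoReps c) (h' : t' ∈ isoReps c)
    (e : Carrier (semigroup (good_of_mem_isoReps hc h)) ≃*
      Carrier (semigroup (good_of_mem_isoReps hc h'))) : t = t' := by
  rcases eq_or_swap_of_mulEquiv hc e with he | ⟨rfl, rfl⟩ | ⟨rfl, rfl⟩ | ⟨rfl, rfl⟩ | ⟨rfl, rfl⟩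
  · exact he
  · exact absurd h' (tabAB_four_notMem_isoReps hc)
  · exact absurd h (tabAB_four_notMem_isoReps hc)
  · exact absurd h' (op_tabA_three_notMem_isoReps hc)
  · exact absurd h (op_tabA_three_notMem_isoReps hc)

theorem op_eq_of_mem_commReps (hc : 4 ≤ c) (h : t ∈ commReps c) : t.op = t := by
  rcases (mem_commReps hc).mp h with ⟨p, m, -, rfl⟩ | ⟨k, r, -, -, rfl⟩ <;> rfl

theorem mem_commReps_of_ab_eq_ba (hc : 4 ≤ c) (h : t ∈ isoReps c) (hab : t.ab = t.ba) :
    t ∈ commReps c := by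
  rcases (mem_isoReps hc).mp h with h | ⟨m, -, rfl⟩ | ⟨q, k, r, hcond, -, rfl⟩
  · rcases (mem_antiReps hc).mp h with h | ⟨m, -, rfl⟩ | ⟨q, k, r, hcond, rfl⟩
    · exact h
    · have h1 : c + 1 = c + 2 := hab
      omega
    · have h1 : 1 = q := hab
      have := hcond.1
      omega
  · have h1 : c + 2 = c + 1 := hab
    omega
  · have h1 : q = 1 := hab
    have := hcond.1
    omega

theorem op_mem_antiReps (hc : 4 ≤ c) (h : t ∈ isoReps c) (ht : t ∉ antiReps c) :
    t.op ∈ antiReps c := by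
  rcases (mem_isoReps hc).mp h with h | ⟨m, hcond, rfl⟩ | ⟨q, k, r, hcond, -, rfl⟩
  · exact absurd h ht
  · obtain ⟨hp, hq, hm, -, hpm⟩ := hcond
    refine (mem_antiReps hc).mpr (Or.inr (Or.inl ⟨m, ⟨hq, hp, hm, by omega, by omega⟩, ?_⟩))
    ext <;> simp only [op, tabC]
    omega
  · exact (mem_antiReps hc).mpr (Or.inr (Or.inr ⟨q, k, r, hcond, rfl⟩))

/-- Anti-isomorphic representatives are equal. -/
theorem eq_of_mem_antiReps (hc : 4 ≤ c) (h : t ∈ antiReps c) (h' : t' ∈ antiReps c)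
    {g : Good c t} {g' : Good c t'}
    (e : Carrier (semigroup g) ≃* (Carrier (semigroup g'))ᵐᵒᵖ) : t = t' := by
  rcases eq_or_swap_of_mulEquiv hc (e.trans (opMulEquiv g')) with
    he | ⟨rfl, he⟩ | ⟨rfl, he⟩ | ⟨rfl, he⟩ | ⟨rfl, he⟩
  -- Opposite tables with the same orientation have `ab = ba`, so they are commutative and equal to
  -- their opposites.
  · have h1 := ab_le_ba_of_mem_antiReps hc h
    have h2 := ab_le_ba_of_mem_antiReps hc h'
    have h3 : t.ab = t.ba := by
      rw [he] at h1 ⊢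
      exact le_antisymm h1 h2
    have h4 := mem_commReps_of_ab_eq_ba hc (antiReps_subset_isoReps hc h) h3
    rw [← op_eq_of_mem_commReps hc h4, he, op_op]
  · have : t' = tabAB c 4 1 := by rw [← op_op t', he]; rfl
    rw [this] at h'
    exact absurd (antiReps_subset_isoReps hc h') (tabAB_four_notMem_isoReps hc)
  · exact absurd (antiReps_subset_isoReps hc h) (tabAB_four_notMem_isoReps hc)
  · rw [← op_op t', he, op_op]
  · exact absurd h (op_tabA_three_notMem_antiReps hc)

theorem mul_comm_iff (h : Good c t) (hc : 4 ≤ c) (hmem : t ∈ isoReps c) :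
    IsCommutativeSemigroup (semigroup h) ↔ t ∈ commReps c := by
  constructor
  · intro hcomm
    refine mem_commReps_of_ab_eq_ba hc hmem ?_
    obtain ⟨x, hx⟩ := exists_code_eq (s := semigroup h) (i := 2) (by omega)
    obtain ⟨y, hy⟩ := exists_code_eq (s := semigroup h) (i := 0) (by omega)
    have := congrArg code (hcomm x y)
    rwa [code_mul, code_mul, hx, hy] at this
  · intro ht x y
    apply code_injective
    rw [code_mul, code_mul, ← mul_op, op_eq_of_mem_commReps hc ht]

end Tab

theorem IsCommutativeSemigroup.of_mulEquiv {n : ℕ} {s s' : Semigroup (Fin n)}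
    (h : IsCommutativeSemigroup s) (e : Carrier s' ≃* Carrier s) : IsCommutativeSemigroup s' :=
  fun a b => e.injective (by rw [map_mul, map_mul, h])

open Tab

theorem exists_isoReps_mulEquiv {c : ℕ} (hc : 4 ≤ c) (s : Semigroup (Fin (c + 3)))
    (hs : IsCoclassTwoTwoGenerated s) : ∃ (t : Tab) (h : t ∈ isoReps c),
      Nonempty (Carrier (semigroup (good_of_mem_isoReps hc h)) ≃* Carrier s) := by
  obtain ⟨t, h, ⟨e⟩⟩ := exists_good_of_isCoclassTwoTwoGenerated hc s hs
  obtain ⟨t', h', ⟨f⟩⟩ := exists_mem_isoReps hc h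
  exact ⟨t', h', ⟨f.trans e.symm⟩⟩

theorem countUpTo_iso {c : ℕ} (hc : 4 ≤ c) :
    countUpTo (isoSetoid (c + 3)) IsCoclassTwoTwoGenerated = #(isoReps c) :=
  countUpTo_eq_card _ _ _ (fun _ h => good_of_mem_isoReps hc h)
    (fun _ _ => isCoclassTwoTwoGenerated _ hc) (fun s hs => exists_isoReps_mulEquiv hc s hs)
    (fun _ _ h h' ⟨e⟩ => eq_of_mem_isoReps hc h h' e)

theorem countUpTo_isoOrAnti {c : ℕ} (hc : 4 ≤ c) :
    countUpTo (isoOrAntiSetoid (c + 3)) IsCoclassTwoTwoGenerated = #(antiReps c) := by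
  refine countUpTo_eq_card _ _ _
    (fun _ h => good_of_mem_isoReps hc (antiReps_subset_isoReps hc h))
    (fun _ _ => isCoclassTwoTwoGenerated _ hc) (fun s hs => ?_) ?_
  · obtain ⟨t, h, ⟨e⟩⟩ := exists_isoReps_mulEquiv hc s hs
    by_cases ht : t ∈ antiReps c
    · exact ⟨t, ht, Or.inl ⟨e⟩⟩
    · exact ⟨t.op, op_mem_antiReps hc h ht, Or.inr
        ⟨(opMulEquiv (good_of_mem_isoReps hc h)).symm.trans (MulEquiv.op e)⟩⟩
  · rintro t t' h h' (⟨⟨e⟩⟩ | ⟨⟨e⟩⟩)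
    · exact eq_of_mem_isoReps hc (antiReps_subset_isoReps hc h) (antiReps_subset_isoReps hc h') e
    · exact eq_of_mem_antiReps hc h h' e

theorem countUpTo_comm {c : ℕ} (hc : 4 ≤ c) :
    countUpTo (isoSetoid (c + 3)) (fun s => IsCoclassTwoTwoGenerated s ∧ IsCommutativeSemigroup s) =
      #(commReps c) := by
  have hsub : ∀ t ∈ commReps c, t ∈ isoReps c := fun t h =>
    antiReps_subset_isoReps hc (commReps_subset_antiReps hc h)
  refine countUpTo_eq_card _ _ _ (fun _ h => good_of_mem_isoReps hc (hsub _ h))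
    (fun t h => ⟨isCoclassTwoTwoGenerated _ hc, (mul_comm_iff _ hc (hsub t h)).mpr h⟩)
    (fun s ⟨hs, hcomm⟩ => ?_) (fun _ _ h h' ⟨e⟩ => eq_of_mem_isoReps hc (hsub _ h) (hsub _ h') e)
  obtain ⟨t, h, ⟨e⟩⟩ := exists_isoReps_mulEquiv hc s hs
  exact ⟨t, (mul_comm_iff _ hc h).mp (hcomm.of_mulEquiv e), ⟨e⟩⟩

end CoclassCount

theorem mainTheorem7 (n : ℕ) (hn : 7 ≤ n) :
    (CoclassCount.countUpTo (CoclassCount.isoOrAntiSetoid n)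
        CoclassCount.IsCoclassTwoTwoGenerated : ℤ)
      = 5 * (n : ℤ) + ⌊(n : ℚ) / 2⌋ - ⌈(n : ℚ) / 3⌉ - 1 ∧
    (CoclassCount.countUpTo (CoclassCount.isoSetoid n)
        CoclassCount.IsCoclassTwoTwoGenerated : ℤ)
      = 7 * (n : ℤ) - ⌈(n : ℚ) / 3⌉ + 5 ∧
    (CoclassCount.countUpTo (CoclassCount.isoSetoid n)
        (fun s => CoclassCount.IsCoclassTwoTwoGenerated s ∧
          CoclassCount.IsCommutativeSemigroup s) : ℤ)
      = 3 * (n : ℤ) + 2 * ⌊(n : ℚ) / 2⌋ - ⌈(n : ℚ) / 3⌉ - 8 := by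
  obtain ⟨c, rfl⟩ : ∃ c, n = c + 3 := ⟨n - 3, by omega⟩
  have hc : 4 ≤ c := by omega
  have hfloor : ⌊((c + 3 : ℕ) : ℚ) / 2⌋ = (((c + 3) / 2 : ℕ) : ℤ) := by
    exact_mod_cast Rat.floor_natCast_div_natCast (c + 3) 2
  have hceil : ⌈((c + 3 : ℕ) : ℚ) / 3⌉ = (((c + 5) / 3 : ℕ) : ℤ) := by
    rw [Int.ceil_eq_iff, lt_div_iff₀ (by norm_num), div_le_iff₀ (by norm_num)]
    constructor
    · have : (((c + 5) / 3 : ℕ) : ℤ) * 3 - 3 < ((c + 3 : ℕ) : ℤ) := by omega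
      have h : ((((c + 5) / 3 : ℕ) : ℤ) * 3 - 3 : ℚ) < ((c + 3 : ℕ) : ℚ) := by exact_mod_cast this
      linarith
    · have : c + 3 ≤ (c + 5) / 3 * 3 := by omega
      exact_mod_cast this
  rw [CoclassCount.countUpTo_isoOrAnti hc, CoclassCount.countUpTo_iso hc,
    CoclassCount.countUpTo_comm hc, CoclassCount.Tab.card_antiReps hc,
    CoclassCount.Tab.card_isoReps hc, CoclassCount.Tab.card_commReps hc, hfloor, hceil]
  -- With `n = c + 3`, `(c + 3) / 2 + (c + 4) / 2 = c + 3`; so the halves cancel in the count up to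
  -- isomorphism.
  omega
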